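/- Let $\mathcal X\subset\mathbb R^{n}$ and $\mathcal Y\subset\mathbb R^{m}$ be nonempty compact convex sets with diameters $D_{\mathcal X},D_{\mathcal Y}$, and let $\mathcal L:\mathbb R^n\times\mathbb R^m\to\mathbb R$ be continuously differentiable on an open set containing $\mathcal X\times\mathcal Y$ and convex-concave over $\mathcal X\times\mathcal Y$, with $\mathcal L(x,\cdot)$ $\mu$-strongly concave on $\mathcal Y$ for every $x\in\mathcal X$, for some $\mu\ge 0$ (plain concavity if $\mu=0$). Let $L_{xx},L_{yy}\ge0$, $L_{yx}>0$ be such that for all $(x,y),(x',y')\in\mathcal X\times\mathcal Y$ $$\|\nabla_x\mathcal L(x,y)-\nabla_x\mathcal L(x',y')\|\le L_{xx}\|x-x'\|+L_{yx}\|y-y'\|,\qquad \|\nabla_y\mathcal L(x,y)-\nabla_y\mathcal L(x',y')\|\le L_{yx}\|x-x'\|+L_{yy}\|y-y'\|.$$ Given $x_0\in\mathcal X$, $y_0\in\mathcal Y$, put $\mathcal L_\beta(x,y)=\mathcal L(x,y)-\frac\beta2\|y-y_0\|^2$ and let $(x_t,y_t)_{t\ge0}$ be generated by $$v_t\in\operatorname*{argmin}_{v\in\mathcal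 X}\langle\nabla_x\mathcal L(x_t,y_t),v\rangle,\qquad x_{t+1}=x_t+\tau_t(v_t-x_t),\qquad y_{t+1}=\operatorname*{argmin}_{u\in\mathcal Y}\Big\|y_t+\tfrac{1}{L_{yy}+\beta_t}\nabla_y\mathcal L_{\beta_t}(x_t,y_t)-u\Big\|^2 ,$$ with step sizes satisfying $\frac1{t+1}\le\tau_t\le\min\{1,\frac{c}{t+1}\}$ for all $t\ge0$ and a constant $c$ (for example $\tau_t=\frac1{t+1}$). Let $f(x)=\max_{u\in\mathcal Y}\mathcal L(x,u)$, $G^{\mathrm{opt}}_{\mathcal X}(x)=f(x)-\min_{v\in\mathcal X}f(v)$ and $G_{\mathcal Y}(x,y)=\max_{u\in\mathcal Y}\mathcal L(x,u)-\mathcal L(x,y)$. (i) (C-C) Suppose that $(\beta_t)$ is nonincreasing and $c_1(t+1)^{-1/3}\le\beta_t\le c_2(t+1)^{-1/3}$ for all $t\ge0$, with constants $c_1,c_2>0$ (for example $\beta_t=C(t+1)^{-1/3}$, $C>0$). Then for every $T\ge1$ $$G^{\mathrm{opt}}_{\mathcal X}(x_T)\le K(1+\log T)^k\,T^{-1/3},\qquad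 \frac1T\sum_{t=1}^TG_{\mathcal Y}(x_t,y_t)\le K\,T^{-1/3}.$$ (ii) (C-SC) Suppose that $\mu>0$ and $\beta_t=0$ for all $t$. Then for every $T\ge1$ $$G^{\mathrm{opt}}_{\mathcal X}(x_T)\le K(1+\log T)^k\,T^{-1},\qquad \frac1T\sum_{t=1}^TG_{\mathcal Y}(x_t,y_t)\le K\,T^{-1}.$$ Here $k\in\mathbb N$ is an absolute constant, and $K$ depends only on $\mu,L_{xx},L_{yx},L_{yy},D_{\mathcal X},D_{\mathcal Y},c$ (and on $c_1,c_2$ in (i)); in particular neither depends on $T$, on the dimensions, on the initial points or on the choices of $v_t$. -/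

import Mathlib

open scoped RealInnerProductSpace

noncomputable section

namespace SaddleLMOPO

/-- `ℝⁿ` with its Euclidean norm. -/
abbrev Euc (n : ℕ) : Type := EuclideanSpace ℝ (Fin n)

/-- The partial gradient `∇ₓ L(x, y)`. -/
def gradX {n m : ℕ} (L : Euc n → Euc m → ℝ) (x : Euc n) (y : Euc m) : Euc n :=
  gradient (fun x' => L x' y) x

/-- The partial gradient `∇_y L(x, y)`. -/
def gradY {n m : ℕ} (L : Euc n → Euc m → ℝ) (x : Euc n) (y : Euc m) : Euc m :=
  gradient (fun y' => L x y') y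

/-- The regularized payoff `L_β(x, y) = L(x, y) - (β / 2) ‖y - y₀‖²` with reference point `y₀`. -/
def regPayoff {n m : ℕ} (L : Euc n → Euc m → ℝ) (y₀ : Euc m) (β : ℝ)
    (x : Euc n) (y : Euc m) : ℝ :=
  L x y - β / 2 * ‖y - y₀‖ ^ 2

/-- The possible answers of a linear minimization oracle over `U` in direction `d`:
all minimizers of `v ↦ ⟪d, v⟫` over `U`. -/
def lmo {n : ℕ} (U : Set (Euc n)) (d : Euc n) : Set (Euc n) :=
  {v | v ∈ U ∧ ∀ w ∈ U, ⟪d, v⟫ ≤ ⟪d, w⟫}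

/-- The answers of a projection oracle over `U` at `u`: all minimizers of `v ↦ ‖u - v‖²` over `U`
(exactly one point when `U` is nonempty, closed and convex). -/
def projOracle {n : ℕ} (U : Set (Euc n)) (u : Euc n) : Set (Euc n) :=
  {v | v ∈ U ∧ ∀ w ∈ U, ‖u - v‖ ^ 2 ≤ ‖u - w‖ ^ 2}

/-- Standing assumptions on the problem `min_{x ∈ X} max_{y ∈ Y} L(x, y)`: compact convex feasible
sets with diameters `DX`, `DY`, `μ`-strong concavity in `y` (plain concavity if `μ = 0`),
continuous differentiability near `X × Y`, and Lipschitz partial gradients. -/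
structure Assumptions {n m : ℕ} (X : Set (Euc n)) (Y : Set (Euc m)) (L : Euc n → Euc m → ℝ)
    (μ Lxx Lyx Lyy DX DY : ℝ) : Prop where
  isCompact_X : IsCompact X
  convex_X : Convex ℝ X
  isCompact_Y : IsCompact Y
  convex_Y : Convex ℝ Y
  diam_X : Metric.diam X = DX
  diam_Y : Metric.diam Y = DY
  mu_nonneg : 0 ≤ μ
  strongConcave : ∀ x ∈ X, StrongConcaveOn Y μ (fun y => L x y)
  contDiff : ∃ U : Set (Euc n × Euc m), IsOpen U ∧ X ×ˢ Y ⊆ U ∧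
    ContDiffOn ℝ 1 (fun p : Euc n × Euc m => L p.1 p.2) U
  Lxx_nonneg : 0 ≤ Lxx
  Lyy_nonneg : 0 ≤ Lyy
  Lyx_pos : 0 < Lyx
  lipschitz_gradX : ∀ x ∈ X, ∀ x' ∈ X, ∀ y ∈ Y, ∀ y' ∈ Y,
    ‖gradX L x y - gradX L x' y'‖ ≤ Lxx * ‖x - x'‖ + Lyx * ‖y - y'‖
  lipschitz_gradY : ∀ x ∈ X, ∀ x' ∈ X, ∀ y ∈ Y, ∀ y' ∈ Y,
    ‖gradY L x y - gradY L x' y'‖ ≤ Lyx * ‖x - x'‖ + Lyy * ‖y - y'‖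

/-- `L` is convex-concave over `X × Y`. -/
def ConvexConcave {n m : ℕ} (X : Set (Euc n)) (Y : Set (Euc m)) (L : Euc n → Euc m → ℝ) : Prop :=
  (∀ y ∈ Y, ConvexOn ℝ X (fun x => L x y)) ∧ (∀ x ∈ X, ConcaveOn ℝ Y (fun y => L x y))

/-- `(x t, y t)` is a run of the hybrid algorithm that makes a linear minimization (Frank-Wolfe)
step of size `τ t` in `x` and a projected gradient ascent step of size `1 / (Lyy + β t)` on the
regularized payoff in `y`; the reference point of the regularization is the initial point `y 0`. -/
structure IsRun {n m : ℕ} (X : Set (Euc n)) (Y : Set (Euc m)) (L : Euc n → Euc m → ℝ)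
    (Lyy : ℝ) (τ β : ℕ → ℝ) (x : ℕ → Euc n) (y : ℕ → Euc m) : Prop where
  x_init : x 0 ∈ X
  y_init : y 0 ∈ Y
  x_step : ∀ t, ∃ v ∈ lmo X (gradX L (x t) (y t)), x (t + 1) = x t + τ t • (v - x t)
  y_step : ∀ t, y (t + 1) ∈ projOracle Y
    (y t + (1 / (Lyy + β t)) • gradY (regPayoff L (y 0) (β t)) (x t) (y t))

/-- The primal function `f(x) = max_{y ∈ Y} L(x, y)`. -/
def primal {n m : ℕ} (Y : Set (Euc m)) (L : Euc n → Euc m → ℝ) (x : Euc n) : ℝ :=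
  sSup ((fun u => L x u) '' Y)

/-- The dual gap `G_Y(x, y) = max_{u ∈ Y} L(x, u) - L(x, y)`. -/
def dualGap {n m : ℕ} (Y : Set (Euc m)) (L : Euc n → Euc m → ℝ) (x : Euc n) (y : Euc m) : ℝ :=
  sSup ((fun u => L x u) '' Y) - L x y

/-- The primal optimality gap `f(x) - min_{v ∈ X} f(v)`. -/
def primalGap {n m : ℕ} (X : Set (Euc n)) (Y : Set (Euc m)) (L : Euc n → Euc m → ℝ)
    (x : Euc n) : ℝ :=
  primal Y L x - sInf (primal Y L '' X)

/-- Step sizes of exact order `1 / t`, with lower constant one, in `[0, 1]`;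
`τ t = 1 / (t + 1)` is the case `c = 1`. -/
def IsStepSize (c : ℝ) (τ : ℕ → ℝ) : Prop :=
  ∀ t : ℕ, 1 / ((t : ℝ) + 1) ≤ τ t ∧ τ t ≤ c / ((t : ℝ) + 1) ∧ τ t ≤ 1

/-- Nonincreasing smoothing parameters of exact order `t ^ (-b)`;
`β t = C * (t + 1) ^ (-b)` is the case `c₁ = c₂ = C`. -/
def IsSmoothing (b c₁ c₂ : ℝ) (β : ℕ → ℝ) : Prop :=
  Antitone β ∧ ∀ t : ℕ, c₁ * ((t : ℝ) + 1) ^ (-b) ≤ β t ∧ β t ≤ c₂ * ((t : ℝ) + 1) ^ (-b)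

end SaddleLMOPO

end

namespace SaddleLMOPO

open Filter Topology Set

/-! ### First-order inequalities for (strongly) concave and smooth functions. -/

section Hilbert

variable {F : Type*} [NormedAddCommGroup F] [InnerProductSpace ℝ F]

/-! Let `u t` maximize the regularized payoff `L_{β t}(x t, ·)` over `Y` and put `d t = ‖y t - u
t‖`. Both gaps reduce to sums of `d t` or `d t ^ 2`. Let `σ t` be a modulus of strong concavity of
that payoff: `β t` in the convex-concave case, `μ` in the strongly concave one. An ascent step
shrinks the distance to `u t` by the factor `1 - σ t / (2 * Λ)` (`contraction`), while the maximizer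
moves by at most `(Lyx * c * DX / (t + 1) + (β t - β (t + 1)) * DY) / σ (t + 1)`
(`norm_sub_argmax_le`). Together they give the recursion `tracking`.

Primal gap: against any competitor `p`, the gap of `f_β(x) = max_u L_β(x, u)` contracts by `1 - τ
t`, with an error `τ t` times a multiple of `(1 + 1 / σ t) / (t + 1) + d t` (`frankWolfe_step`).
Since `(t + 1) * τ t ≥ 1`, weighting the gap by `t` makes it telescope, so `T` times the gap is at
most a sum of these errors plus the bias of the regularization (`primalGap_mul_le`). Dual gap: it is
at most `Λ / 2 * d t ^ 2` plus the bias and the cost of the move in `x` (`dualGap_succ_le`).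

Convex-concave case: dividing the recursion by `β t` bounds the sum of `d t` by that of `1 / ((t +
1) * β t * β (t + 1))`, of order `T ^ (2 / 3)`; the exponent `1 / 3` balances this against the bias
`∑ β t`, and no logarithm appears. Strongly concave case: the contraction factor is constant, so `∑
d t` is of order `1 + log T` and `∑ d t ^ 2` is bounded; only the primal bound carries a logarithm.
-/

theorem hasDerivAt_lineMap_of_hasGradientAt [CompleteSpace F] {φ : F → ℝ} {g y d : F} {s : ℝ}
    (hg : HasGradientAt φ g (y + s • d)) :
    HasDerivAt (fun b : ℝ => φ (y + b • d)) ⟪g, d⟫ s := by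
  have h1 : HasDerivAt (fun b : ℝ => y + b • d) d s := by
    simpa using ((hasDerivAt_id s).smul_const d).const_add y
  exact (hg.hasFDerivAt.comp_hasDerivAt s h1).congr_deriv (by simp)

/-- Strong concavity along the segment, divided by its parameter `b`, in the limit `b → 0⁺`. -/
theorem StrongConcaveOn.le_inner_gradient [CompleteSpace F] {s : Set F} {φ : F → ℝ} {σ : ℝ}
    {g y u : F} (h : StrongConcaveOn s σ φ) (hy : y ∈ s) (hu : u ∈ s) (hg : HasGradientAt φ g y) :
    φ u ≤ φ y + ⟪g, u - y⟫ - σ / 2 * ‖u - y‖ ^ 2 := by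
  have hd : HasDerivAt (fun b : ℝ => φ (y + b • (u - y))) ⟪g, u - y⟫ 0 :=
    hasDerivAt_lineMap_of_hasGradientAt (by simpa using hg)
  have hl := hd.tendsto_slope_zero_right
  have hr : Tendsto (fun b : ℝ => φ u - φ y + (1 - b) * (σ / 2 * ‖u - y‖ ^ 2)) (𝓝[>] 0)
      (𝓝 (φ u - φ y + (1 - 0) * (σ / 2 * ‖u - y‖ ^ 2))) :=
    (Continuous.tendsto (by fun_prop) _).mono_left nhdsWithin_le_nhds
  have key := le_of_tendsto_of_tendsto hr hl (by
    filter_upwards [Ioo_mem_nhdsGT (zero_lt_one' ℝ)] with b hb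
    have h2 := h.2 hy hu (sub_nonneg.2 hb.2.le) hb.1.le (by ring)
    have e : (1 - b) • y + b • u = y + (0 + b) • (u - y) := by module
    rw [e, norm_sub_rev y u] at h2
    simp only [smul_eq_mul] at h2 ⊢
    rw [inv_mul_eq_div, le_div_iff₀ hb.1]
    simp only [zero_smul, add_zero]
    nlinarith)
  linarith

theorem ConvexOn.inner_gradient_le [CompleteSpace F] {s : Set F} {φ : F → ℝ}
    {g y u : F} (h : ConvexOn ℝ s φ) (hy : y ∈ s) (hu : u ∈ s) (hg : HasGradientAt φ g y) :
    φ y + ⟪g, u - y⟫ ≤ φ u := by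
  have h1 : StrongConcaveOn s 0 (-φ) := strongConcaveOn_zero.2 h.neg
  have h2 : HasGradientAt (-φ) (-g) y := by
    rw [hasGradientAt_iff_hasFDerivAt] at hg ⊢
    simpa using hg.neg
  have := StrongConcaveOn.le_inner_gradient h1 hy hu h2
  simp only [Pi.neg_apply, inner_neg_left] at this
  linarith

/-- The same limit without differentiability: maximality replaces the first-order term. -/
theorem StrongConcaveOn.growth_of_isMaxOn {s : Set F} {φ : F → ℝ} {σ : ℝ} {y u : F}
    (h : StrongConcaveOn s σ φ) (hy : y ∈ s) (hu : u ∈ s) (hm : IsMaxOn φ s y) :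
    φ u + σ / 2 * ‖u - y‖ ^ 2 ≤ φ y := by
  have hr : Tendsto (fun b : ℝ => φ u + (1 - b) * (σ / 2 * ‖u - y‖ ^ 2)) (𝓝[>] 0)
      (𝓝 (φ u + (1 - 0) * (σ / 2 * ‖u - y‖ ^ 2))) :=
    (Continuous.tendsto (by fun_prop) _).mono_left nhdsWithin_le_nhds
  have key := le_of_tendsto hr (b := φ y) (by
    filter_upwards [Ioo_mem_nhdsGT (zero_lt_one' ℝ)] with b hb
    have h2 := h.2 hy hu (sub_nonneg.2 hb.2.le) hb.1.le (by ring)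
    have h3 := hm (h.1 hy hu (sub_nonneg.2 hb.2.le) hb.1.le (by ring))
    rw [norm_sub_rev y u] at h2
    simp only [smul_eq_mul, mem_ofPred_eq] at h2 h3
    have := h2.trans h3
    have hb1 := hb.1
    by_contra! hc
    nlinarith)
  linarith

theorem descent_of_lipschitz_gradient [CompleteSpace F] {s : Set F} (hs : Convex ℝ s) {φ : F → ℝ}
    {G : F → F} {M : ℝ} {y z : F} (hG : ∀ w ∈ s, HasGradientAt φ (G w) w)
    (hM : ∀ w ∈ s, ‖G w - G y‖ ≤ M * ‖w - y‖) (hy : y ∈ s) (hz : z ∈ s) :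
    φ y + ⟪G y, z - y⟫ - M / 2 * ‖z - y‖ ^ 2 ≤ φ z := by
  have hmem : ∀ b ∈ Icc (0 : ℝ) 1, y + b • (z - y) ∈ s := fun b hb =>
    hs.add_smul_sub_mem hy hz hb
  -- The Lipschitz bound makes this auxiliary function of `b` nondecreasing on `[0, 1]`; the claim
  -- compares its two endpoints.
  have hd : ∀ b ∈ Icc (0 : ℝ) 1, HasDerivAt
      (fun b : ℝ => φ (y + b • (z - y)) - b * ⟪G y, z - y⟫ + M / 2 * ‖z - y‖ ^ 2 * b ^ 2)
      (⟪G (y + b • (z - y)), z - y⟫ - ⟪G y, z - y⟫ + M / 2 * ‖z - y‖ ^ 2 * (2 * b)) b := by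
    intro b hb
    have h1 := hasDerivAt_lineMap_of_hasGradientAt (hG _ (hmem b hb))
    have h2 := (hasDerivAt_id b).mul_const ⟪G y, z - y⟫
    have h3 := (hasDerivAt_pow 2 b).const_mul (M / 2 * ‖z - y‖ ^ 2)
    exact ((h1.sub h2).add h3).congr_deriv (by simp)
  have hmono := monotoneOn_of_deriv_nonneg (convex_Icc (0 : ℝ) 1)
    (fun b hb => (hd b hb).continuousAt.continuousWithinAt)
    (fun b hb => (hd b (interior_subset hb)).differentiableAt.differentiableWithinAt) (by
      intro b hb
      have hb' := interior_subset hb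
      rw [(hd b hb').deriv, ← inner_sub_left]
      have h1 := hM _ (hmem b hb')
      rw [add_sub_cancel_left, norm_smul, Real.norm_of_nonneg hb'.1] at h1
      have h2 := neg_le_of_abs_le
        (abs_real_inner_le_norm (G (y + b • (z - y)) - G y) (z - y))
      have h3 := mul_le_mul_of_nonneg_right h1 (norm_nonneg (z - y))
      nlinarith)
  have := hmono (left_mem_Icc.2 zero_le_one) (right_mem_Icc.2 zero_le_one) zero_le_one
  simp at this
  linarith

end Hilbert

/-! ### The payoff, its regularization and the stability of maximizers. -/

section Analysis

variable {n m : ℕ} {X : Set (Euc n)} {Y : Set (Euc m)} {L : Euc n → Euc m → ℝ}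
  {μ Lxx Lyx Lyy DX DY : ℝ}

namespace Assumptions

theorem differentiableAt (h : Assumptions X Y L μ Lxx Lyx Lyy DX DY) {x : Euc n} {y : Euc m}
    (hx : x ∈ X) (hy : y ∈ Y) :
    DifferentiableAt ℝ (fun p : Euc n × Euc m => L p.1 p.2) (x, y) := by
  obtain ⟨U, hU, hsub, hc⟩ := h.contDiff
  exact (hc.differentiableOn one_ne_zero).differentiableAt
    (hU.mem_nhds (hsub ⟨hx, hy⟩))

theorem hasGradientAt_gradX (h : Assumptions X Y L μ Lxx Lyx Lyy DX DY) {x : Euc n} {y : Euc m}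
    (hx : x ∈ X) (hy : y ∈ Y) : HasGradientAt (fun x' => L x' y) (gradX L x y) x :=
  ((h.differentiableAt hx hy).comp (f := fun x' : Euc n => (x', y)) x
    (by fun_prop)).hasGradientAt

theorem hasGradientAt_gradY (h : Assumptions X Y L μ Lxx Lyx Lyy DX DY) {x : Euc n} {y : Euc m}
    (hx : x ∈ X) (hy : y ∈ Y) : HasGradientAt (fun y' => L x y') (gradY L x y) y :=
  ((h.differentiableAt hx hy).comp (f := fun y' : Euc m => (x, y')) y
    (by fun_prop)).hasGradientAt

theorem hasGradientAt_regPayoff (h : Assumptions X Y L μ Lxx Lyx Lyy DX DY) {x : Euc n}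
    {y : Euc m} (hx : x ∈ X) (hy : y ∈ Y) (y₀ : Euc m) (β : ℝ) :
    HasGradientAt (fun y' => regPayoff L y₀ β x y') (gradY L x y - β • (y - y₀)) y := by
  have h1 := (h.hasGradientAt_gradY hx hy).hasFDerivAt
  have h2 : HasFDerivAt (fun y' : Euc m => ‖y' - y₀‖ ^ 2) (2 • (innerSL ℝ (y - y₀))) y := by
    simpa using ((hasFDerivAt_id y).sub_const y₀).norm_sq
  rw [hasGradientAt_iff_hasFDerivAt]
  refine (h1.sub (h2.const_mul (β / 2))).congr_fderiv ?_
  ext v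
  simp
  ring

theorem gradY_regPayoff (h : Assumptions X Y L μ Lxx Lyx Lyy DX DY) {x : Euc n}
    {y : Euc m} (hx : x ∈ X) (hy : y ∈ Y) (y₀ : Euc m) (β : ℝ) :
    gradY (regPayoff L y₀ β) x y = gradY L x y - β • (y - y₀) :=
  (h.hasGradientAt_regPayoff hx hy y₀ β).gradient

theorem continuousOn_regPayoff (h : Assumptions X Y L μ Lxx Lyx Lyy DX DY) {x : Euc n}
    (hx : x ∈ X) (y₀ : Euc m) (β : ℝ) : ContinuousOn (regPayoff L y₀ β x) Y := fun _ hy =>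
  (h.hasGradientAt_regPayoff hx hy y₀ β).hasFDerivAt.continuousAt.continuousWithinAt

theorem exists_isMaxOn_regPayoff (h : Assumptions X Y L μ Lxx Lyx Lyy DX DY) {x : Euc n}
    (hx : x ∈ X) (hY : Y.Nonempty) (y₀ : Euc m) (β : ℝ) :
    ∃ u ∈ Y, IsMaxOn (regPayoff L y₀ β x) Y u :=
  h.isCompact_Y.exists_isMaxOn hY (h.continuousOn_regPayoff hx y₀ β)

theorem strongConcaveOn_regPayoff (h : Assumptions X Y L μ Lxx Lyx Lyy DX DY) {x : Euc n}
    (hx : x ∈ X) (y₀ : Euc m) {β σ : ℝ} (hσ : σ ≤ μ + β) :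
    StrongConcaveOn Y σ (regPayoff L y₀ β x) := by
  have h1 := strongConcaveOn_iff_convex.1 (h.strongConcave x hx)
  refine StrongConcaveOn.mono hσ (strongConcaveOn_iff_convex.2 ?_)
  -- Adding `(μ + β) / 2 * ‖y‖ ^ 2` to the regularized payoff leaves `L + μ / 2 * ‖y‖ ^ 2` plus this
  -- affine function.
  have h2 : ConcaveOn ℝ Y (fun y : Euc m => β * ⟪y, y₀⟫ - β / 2 * ‖y₀‖ ^ 2) := by
    refine ⟨h.convex_Y, fun a _ b _ p q _ _ hpq => ?_⟩
    simp only [smul_eq_mul, inner_add_left, inner_smul_left, RCLike.conj_to_real]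
    apply le_of_eq
    linear_combination (- (β / 2 * ‖y₀‖ ^ 2)) * hpq
  refine (h1.add h2).congr fun y _ => ?_
  simp only [Pi.add_apply, regPayoff, norm_sub_sq_real]
  ring

theorem norm_sub_le_X (h : Assumptions X Y L μ Lxx Lyx Lyy DX DY) {x x' : Euc n}
    (hx : x ∈ X) (hx' : x' ∈ X) : ‖x - x'‖ ≤ DX := by
  rw [← dist_eq_norm, ← h.diam_X]
  exact Metric.dist_le_diam_of_mem h.isCompact_X.isBounded hx hx'

theorem norm_sub_le_Y (h : Assumptions X Y L μ Lxx Lyx Lyy DX DY) {y y' : Euc m}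
    (hy : y ∈ Y) (hy' : y' ∈ Y) : ‖y - y'‖ ≤ DY := by
  rw [← dist_eq_norm, ← h.diam_Y]
  exact Metric.dist_le_diam_of_mem h.isCompact_Y.isBounded hy hy'

theorem DX_nonneg (h : Assumptions X Y L μ Lxx Lyx Lyy DX DY) : 0 ≤ DX :=
  h.diam_X ▸ Metric.diam_nonneg

theorem DY_nonneg (h : Assumptions X Y L μ Lxx Lyx Lyy DX DY) : 0 ≤ DY :=
  h.diam_Y ▸ Metric.diam_nonneg

/-- The mixed second difference of the payoff is controlled by the coupling constant. -/
theorem mixed_difference_le (h : Assumptions X Y L μ Lxx Lyx Lyy DX DY) {x x' : Euc n}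
    {y y' : Euc m} (hx : x ∈ X) (hx' : x' ∈ X) (hy : y ∈ Y) (hy' : y' ∈ Y) :
    (L x' y' - L x y') - (L x' y - L x y) ≤ Lyx * ‖x' - x‖ * ‖y' - y‖ := by
  -- Mean value inequality in `x`: the gradient of `L · y' - L · y` has norm at most `Lyx * ‖y' -
  -- y‖`.
  have h1 := h.convex_X.norm_image_sub_le_of_norm_hasFDerivWithin_le
    (f := fun z => L z y' - L z y) (C := Lyx * ‖y' - y‖)
    (fun z hz => ((h.hasGradientAt_gradX hz hy').hasFDerivAt.sub
      (h.hasGradientAt_gradX hz hy).hasFDerivAt).hasFDerivWithinAt)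
    (fun z hz => by
      rw [← map_sub, LinearIsometryEquiv.norm_map]
      simpa using h.lipschitz_gradX z hz z hz y' hy' y hy) hx hx'
  have h2 := (le_abs_self _).trans h1
  linarith

/-- Stability of the maximizers of the regularized payoff. -/
theorem norm_sub_argmax_le (h : Assumptions X Y L μ Lxx Lyx Lyy DX DY) {x x' : Euc n}
    {y₀ u u' : Euc m} {β β' σ : ℝ} (hx : x ∈ X) (hx' : x' ∈ X) (hy₀ : y₀ ∈ Y) (hu : u ∈ Y)
    (hu' : u' ∈ Y) (hm : IsMaxOn (regPayoff L y₀ β x) Y u)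
    (hm' : IsMaxOn (regPayoff L y₀ β' x') Y u') (hβ : β' ≤ β) (hσ : σ ≤ μ + β') :
    σ * ‖u' - u‖ ≤ Lyx * ‖x' - x‖ + (β - β') * DY := by
  have h1 := StrongConcaveOn.growth_of_isMaxOn
    (h.strongConcaveOn_regPayoff hx y₀ (hσ.trans (by linarith : μ + β' ≤ μ + β))) hu hu' hm
  have h2 := StrongConcaveOn.growth_of_isMaxOn (h.strongConcaveOn_regPayoff hx' y₀ hσ) hu' hu hm'
  have h3 := h.mixed_difference_le hx hx' hu hu'
  have h4 : ‖u' - y₀‖ ^ 2 - ‖u - y₀‖ ^ 2 ≤ 2 * DY * ‖u' - u‖ := by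
    have a1 := norm_sub_norm_le (u' - y₀) (u - y₀)
    rw [sub_sub_sub_cancel_right] at a1
    have a2 := h.norm_sub_le_Y hu hy₀
    have a3 := h.norm_sub_le_Y hu' hy₀
    nlinarith [norm_nonneg (u' - u), norm_nonneg (u - y₀), norm_nonneg (u' - y₀)]
  have h5 := mul_le_mul_of_nonneg_left h4 (sub_nonneg.2 hβ)
  rw [norm_sub_rev u u'] at h2
  simp only [regPayoff] at h1 h2
  -- Adding the two growth inequalities leaves a mixed difference of `L` and `(β - β') / 2` times
  -- the difference of squared distances to `y₀`; both are linear in `‖u' - u‖`.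
  have h6 : (σ * ‖u' - u‖) * ‖u' - u‖ ≤ (Lyx * ‖x' - x‖ + (β - β') * DY) * ‖u' - u‖ := by
    nlinarith
  rcases (norm_nonneg (u' - u)).eq_or_lt with h0 | h0
  · rw [← h0, mul_zero]
    have := h.DY_nonneg
    have := h.Lyx_pos
    have : 0 ≤ β - β' := sub_nonneg.2 hβ
    positivity
  · exact le_of_mul_le_mul_right h6 h0

end Assumptions

theorem inner_le_of_mem_projOracle {U : Set (Euc m)} (hU : Convex ℝ U) {p v w : Euc m}
    (hv : v ∈ projOracle U p) (hw : w ∈ U) : ⟪p - v, w - v⟫ ≤ 0 := by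
  have key := (norm_eq_iInf_iff_real_inner_le_zero hU (u := p) hv.1).1 ?_
  · exact key w hw
  · have : Nonempty U := ⟨⟨v, hv.1⟩⟩
    refine le_antisymm (le_ciInf fun w => ?_)
      (ciInf_le ⟨0, fun _ ⟨_, h⟩ => h ▸ norm_nonneg _⟩ (⟨v, hv.1⟩ : U))
    exact (sq_le_sq₀ (norm_nonneg _) (norm_nonneg _)).1 (hv.2 w w.2)

end Analysis

/-! ### One step of the algorithm. -/

section

variable {n m : ℕ} {X : Set (Euc n)} {Y : Set (Euc m)} {L : Euc n → Euc m → ℝ}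
  {μ Lxx Lyx Lyy DX DY : ℝ}

theorem primal_eq_of_isMaxOn {M : Euc n → Euc m → ℝ} {x : Euc n} {u : Euc m} (hu : u ∈ Y)
    (hm : IsMaxOn (M x) Y u) : primal Y M x = M x u :=
  IsGreatest.csSup_eq ⟨⟨u, hu, rfl⟩, by rintro _ ⟨w, hw, rfl⟩; exact hm hw⟩

theorem regPayoff_zero (L : Euc n → Euc m → ℝ) (y₀ : Euc m) : regPayoff L y₀ 0 = L := by
  funext x y
  simp [regPayoff]

theorem primalGap_le {r : ℝ} {x : Euc n} (hx : x ∈ X)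
    (h : ∀ z ∈ X, primal Y L x - primal Y L z ≤ r) : primalGap X Y L x ≤ r := by
  have : primal Y L x - r ≤ sInf (primal Y L '' X) :=
    le_csInf ⟨_, x, hx, rfl⟩ (by rintro _ ⟨z, hz, rfl⟩; linarith [h z hz])
  unfold primalGap
  linarith

namespace Assumptions

theorem lipschitz_gradY_regPayoff (h : Assumptions X Y L μ Lxx Lyx Lyy DX DY) {x : Euc n}
    {y y' : Euc m} (hx : x ∈ X) (hy : y ∈ Y) (hy' : y' ∈ Y) (y₀ : Euc m) {β : ℝ} (hβ : 0 ≤ β) :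
    ‖gradY (regPayoff L y₀ β) x y' - gradY (regPayoff L y₀ β) x y‖ ≤ (Lyy + β) * ‖y' - y‖ := by
  rw [h.gradY_regPayoff hx hy, h.gradY_regPayoff hx hy']
  have e : gradY L x y' - β • (y' - y₀) - (gradY L x y - β • (y - y₀))
      = (gradY L x y' - gradY L x y) - β • (y' - y) := by module
  have h1 := h.lipschitz_gradY x hx x hx y' hy' y hy
  simp only [sub_self, norm_zero, mul_zero, zero_add] at h1
  rw [e]
  refine (norm_sub_le _ _).trans ?_
  rw [norm_smul, Real.norm_of_nonneg hβ]
  linarith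

/-- The strong concavity upper bound meets the descent lower bound. Hence `σ ≤ Lyy + β` unless `Y`
is a single point, which settles the degenerate cases below. -/
theorem modulus_mul_sq_le (h : Assumptions X Y L μ Lxx Lyx Lyy DX DY) {x : Euc n}
    {y y' : Euc m} (hx : x ∈ X) (hy : y ∈ Y) (hy' : y' ∈ Y) (y₀ : Euc m) {β σ : ℝ}
    (hβ : 0 ≤ β) (hσ : σ ≤ μ + β) :
    σ * ‖y' - y‖ ^ 2 ≤ (Lyy + β) * ‖y' - y‖ ^ 2 := by
  have hs := h.strongConcaveOn_regPayoff hx y₀ hσ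
  have h1 := StrongConcaveOn.le_inner_gradient hs hy hy' (h.hasGradientAt_regPayoff hx hy y₀ β)
  have h3 := descent_of_lipschitz_gradient (φ := regPayoff L y₀ β x)
    (G := gradY (regPayoff L y₀ β) x) (M := Lyy + β) h.convex_Y
    (fun w hw => by rw [h.gradY_regPayoff hx hw]; exact h.hasGradientAt_regPayoff hx hw y₀ β)
    (fun w hw => h.lipschitz_gradY_regPayoff hx hy hw y₀ hβ) hy hy'
  rw [h.gradY_regPayoff hx hy] at h3
  linarith

/-- One projected gradient ascent step on the regularized payoff. -/
theorem ascent_step (h : Assumptions X Y L μ Lxx Lyx Lyy DX DY) {x : Euc n}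
    {y₀ y z u : Euc m} {β σ : ℝ} (hx : x ∈ X) (hy : y ∈ Y) (hu : u ∈ Y)
    (hz : z ∈ projOracle Y (y + (1 / (Lyy + β)) • gradY (regPayoff L y₀ β) x y))
    (hβ : 0 ≤ β) (hσ0 : 0 < σ) (hσ : σ ≤ μ + β) :
    regPayoff L y₀ β x u - regPayoff L y₀ β x z
      ≤ (Lyy + β) / 2 * ‖u - y‖ ^ 2 - (Lyy + β) / 2 * ‖u - z‖ ^ 2 - σ / 2 * ‖u - y‖ ^ 2 := by
  have hM0 : 0 ≤ Lyy + β := add_nonneg h.Lyy_nonneg hβ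
  -- If `Lyy + β = 0`, the step size is the default value `1 / 0 = 0`, but then `Y` is a single
  -- point.
  rcases hM0.eq_or_lt with hM | hM
  · have hsing : ∀ w ∈ Y, w = u := fun w hw => by
      have h1 := h.modulus_mul_sq_le hx hu hw y₀ hβ hσ
      rw [← hM, zero_mul] at h1
      have : ‖w - u‖ ^ 2 = 0 := le_antisymm (nonpos_of_mul_nonpos_right h1 hσ0) (sq_nonneg _)
      exact sub_eq_zero.1 (norm_eq_zero.1 (pow_eq_zero_iff two_ne_zero |>.1 this))
    rw [hsing z hz.1, hsing y hy]
    simp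
  have h1 := StrongConcaveOn.le_inner_gradient (h.strongConcaveOn_regPayoff hx y₀ hσ) hy hu
    (h.hasGradientAt_regPayoff hx hy y₀ β)
  have h2 := descent_of_lipschitz_gradient (φ := regPayoff L y₀ β x)
    (G := gradY (regPayoff L y₀ β) x) (M := Lyy + β) h.convex_Y
    (fun w hw => by rw [h.gradY_regPayoff hx hw]; exact h.hasGradientAt_regPayoff hx hw y₀ β)
    (fun w hw => h.lipschitz_gradY_regPayoff hx hy hw y₀ hβ) hy hz.1
  have h3 := inner_le_of_mem_projOracle h.convex_Y hz hu
  rw [← h.gradY_regPayoff hx hy] at h1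
  set g := gradY (regPayoff L y₀ β) x y
  set M := Lyy + β
  have e1 : y + (1 / M) • g - z = (1 / M) • g - (z - y) := by abel
  rw [e1, inner_sub_left, inner_smul_left, RCLike.conj_to_real] at h3
  have h4 : ⟪g, u - z⟫ ≤ M * ⟪z - y, u - z⟫ := by
    have := mul_le_mul_of_nonneg_left h3 hM0
    rw [mul_sub, ← mul_assoc, mul_one_div_cancel hM.ne'] at this
    linarith
  have h5 : ‖u - y‖ ^ 2 = ‖u - z‖ ^ 2 + 2 * ⟪z - y, u - z⟫ + ‖z - y‖ ^ 2 := by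
    rw [← sub_add_sub_cancel u z y, norm_add_sq_real, real_inner_comm]
  have h6 : ⟪g, u - y⟫ - ⟪g, z - y⟫ = ⟪g, u - z⟫ := by
    rw [← inner_sub_right, sub_sub_sub_cancel_right]
  linear_combination h1 + h2 + h6 + h4 - (M / 2) * h5

/-- The ascent step contracts towards the maximizer of the regularized payoff. -/
theorem contraction (h : Assumptions X Y L μ Lxx Lyx Lyy DX DY) {x : Euc n}
    {y₀ y z u : Euc m} {β σ Λ : ℝ} (hx : x ∈ X) (hy : y ∈ Y) (hu : u ∈ Y)
    (hz : z ∈ projOracle Y (y + (1 / (Lyy + β)) • gradY (regPayoff L y₀ β) x y))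
    (hm : IsMaxOn (regPayoff L y₀ β x) Y u)
    (hβ : 0 ≤ β) (hσ0 : 0 < σ) (hσ : σ ≤ μ + β) (hΛ : Lyy + β ≤ Λ) (hσΛ : σ ≤ Λ) :
    ‖z - u‖ ≤ (1 - σ / (2 * Λ)) * ‖y - u‖ := by
  have hΛ0 : 0 < Λ := hσ0.trans_le hσΛ
  have h1 := h.ascent_step hx hy hu hz hβ hσ0 hσ
  have h2 : regPayoff L y₀ β x z ≤ regPayoff L y₀ β x u := hm hz.1
  have h3 := h.modulus_mul_sq_le hx hu hz.1 y₀ hβ hσ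
  have h7 := h.modulus_mul_sq_le hx hu hy y₀ hβ hσ
  rw [norm_sub_rev u y, norm_sub_rev u z] at h1
  set M := Lyy + β
  have h4 : M * ‖z - u‖ ^ 2 ≤ (M - σ) * ‖y - u‖ ^ 2 := by linarith
  -- Passing from `M` to the larger `Λ` adds `(Λ - M) * ‖z - u‖ ^ 2`, which is absorbed because the
  -- step does not increase the distance to `u`.
  have h5 : Λ * ‖z - u‖ ^ 2 ≤ (Λ - σ) * ‖y - u‖ ^ 2 := by
    have h9 : ‖z - u‖ ^ 2 ≤ ‖y - u‖ ^ 2 := by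
      rcases (sq_nonneg ‖z - u‖).eq_or_lt with h0 | h0
      · rw [← h0]
        positivity
      · have hM := le_of_mul_le_mul_right h3 h0
        refine le_of_mul_le_mul_left (h4.trans ?_) (hσ0.trans_le hM)
        nlinarith [sq_nonneg ‖y - u‖]
    nlinarith
  have h6 : 0 ≤ 1 - σ / (2 * Λ) := by
    rw [sub_nonneg, div_le_one (by positivity)]
    linarith
  refine abs_le_of_sq_le_sq' ?_ (by positivity) |>.2
  -- This is `1 - s ≤ (1 - s / 2) ^ 2` with `s = σ / Λ`, used in place of a square root.
  have e : Λ * ((1 - σ / (2 * Λ)) * ‖y - u‖) ^ 2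
      = (Λ - σ) * ‖y - u‖ ^ 2 + σ ^ 2 / (4 * Λ) * ‖y - u‖ ^ 2 := by
    field_simp
    ring
  refine le_of_mul_le_mul_left ?_ hΛ0
  rw [e]
  have : 0 ≤ σ ^ 2 / (4 * Λ) * ‖y - u‖ ^ 2 := by positivity
  linarith

/-- One Frank-Wolfe step on the regularized primal function. -/
theorem frankWolfe_step (h : Assumptions X Y L μ Lxx Lyx Lyy DX DY) (hc : ConvexConcave X Y L)
    {x x' v p : Euc n} {y₀ y u u' w : Euc m} {β σ τ : ℝ} (hx : x ∈ X) (hy : y ∈ Y) (hp : p ∈ X)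
    (hy₀ : y₀ ∈ Y) (hu : u ∈ Y) (hu' : u' ∈ Y)
    (hv : v ∈ lmo X (gradX L x y)) (hτ0 : 0 ≤ τ) (hτ1 : τ ≤ 1) (hx' : x' = x + τ • (v - x))
    (hm : IsMaxOn (regPayoff L y₀ β x) Y u) (hm' : IsMaxOn (regPayoff L y₀ β x') Y u')
    (hmp : IsMaxOn (regPayoff L y₀ β p) Y w) (hσ0 : 0 < σ) (hσ : σ ≤ μ + β) :
    regPayoff L y₀ β x' u' - regPayoff L y₀ β p w
      ≤ (1 - τ) * (regPayoff L y₀ β x u - regPayoff L y₀ β p w)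
        + τ * (DX * ((Lxx + Lyx ^ 2 / σ) * ‖x' - x‖ + 2 * Lyx * ‖y - u‖)) := by
  have hx'X : x' ∈ X := hx' ▸ h.convex_X.add_smul_sub_mem hx hv.1 ⟨hτ0, hτ1⟩
  have hDX := h.DX_nonneg
  have hLyx := h.Lyx_pos
  -- Convexity is used at the new point `x'` with its own maximizer `u'`, so no smoothness of the
  -- primal function is needed; the gradient is then moved back to the oracle point `(x, y)`.
  have h1 := ConvexOn.inner_gradient_le (hc.1 u' hu') hx'X hx (h.hasGradientAt_gradX hx'X hu')
  have e1 : x - x' = -(τ • (v - x)) := by rw [hx']; abel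
  rw [e1, inner_neg_right, inner_smul_right] at h1
  have h2 : ⟪gradX L x' u', v - x⟫ ≤ ⟪gradX L x y, v - x⟫
      + DX * (Lxx * ‖x' - x‖ + Lyx * ‖u' - y‖) := by
    have a1 := real_inner_le_norm (gradX L x' u' - gradX L x y) (v - x)
    have a2 := mul_le_mul (h.lipschitz_gradX x' hx'X x hx u' hu' y hy) (h.norm_sub_le_X hv.1 hx)
      (norm_nonneg _) ((norm_nonneg _).trans (h.lipschitz_gradX x' hx'X x hx u' hu' y hy))
    rw [inner_sub_left] at a1
    linarith
  have h3 : ⟪gradX L x y, v - x⟫ ≤ ⟪gradX L x y, p - x⟫ := by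
    rw [inner_sub_right, inner_sub_right]
    linarith [hv.2 p hp]
  have h4 : ⟪gradX L x y, p - x⟫ ≤ ⟪gradX L x u, p - x⟫ + DX * (Lyx * ‖y - u‖) := by
    have a1 := real_inner_le_norm (gradX L x y - gradX L x u) (p - x)
    have a0 := h.lipschitz_gradX x hx x hx y hy u hu
    rw [sub_self, norm_zero, mul_zero, zero_add] at a0
    have a2 := mul_le_mul a0 (h.norm_sub_le_X hp hx) (norm_nonneg _) ((norm_nonneg _).trans a0)
    rw [inner_sub_left] at a1
    linarith
  have h5 := ConvexOn.inner_gradient_le (hc.1 u hu) hx hp (h.hasGradientAt_gradX hx hu)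
  have h6 : ‖u' - y‖ ≤ Lyx / σ * ‖x' - x‖ + ‖y - u‖ := by
    have a1 := h.norm_sub_argmax_le hx hx'X hy₀ hu hu' hm hm' le_rfl hσ
    rw [sub_self, zero_mul, add_zero] at a1
    have a2 := norm_sub_le_norm_sub_add_norm_sub u' u y
    rw [norm_sub_rev u y] at a2
    have a3 : ‖u' - u‖ ≤ Lyx / σ * ‖x' - x‖ := by
      rw [div_mul_eq_mul_div, le_div_iff₀ hσ0]
      linarith
    linarith
  have h7 : regPayoff L y₀ β x u' ≤ regPayoff L y₀ β x u := hm hu'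
  have h8 : regPayoff L y₀ β p u ≤ regPayoff L y₀ β p w := hmp hu
  have h9 := mul_le_mul_of_nonneg_left h6 (mul_nonneg hDX hLyx.le)
  have h10 : ⟪gradX L x' u', v - x⟫ ≤ regPayoff L y₀ β p w - regPayoff L y₀ β x u
      + DX * ((Lxx + Lyx ^ 2 / σ) * ‖x' - x‖ + 2 * Lyx * ‖y - u‖) := by
    have e : DX * Lyx * (Lyx / σ * ‖x' - x‖ + ‖y - u‖)
        = DX * (Lyx ^ 2 / σ * ‖x' - x‖) + DX * (Lyx * ‖y - u‖) := by ring
    simp only [regPayoff] at h8 ⊢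
    linarith
  have h11 := mul_le_mul_of_nonneg_left h10 hτ0
  simp only [regPayoff] at h7 h11 ⊢
  linarith

end Assumptions

end

/-! ### Along a run: tracking the maximizer and accumulating the gaps. -/

section

variable {n m : ℕ} {X : Set (Euc n)} {Y : Set (Euc m)} {L : Euc n → Euc m → ℝ}
  {μ Lxx Lyx Lyy DX DY : ℝ} {c : ℝ} {τ β : ℕ → ℝ} {x : ℕ → Euc n} {y : ℕ → Euc m}

theorem IsStepSize.nonneg (hτ : IsStepSize c τ) (t : ℕ) : 0 ≤ τ t :=
  le_trans (by positivity) (hτ t).1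

theorem IsStepSize.one_le (hτ : IsStepSize c τ) : 1 ≤ c := by
  have := (hτ 0).1.trans (hτ 0).2.1
  simpa using this

namespace IsRun

theorem mem_Y (hr : IsRun X Y L Lyy τ β x y) : ∀ t, y t ∈ Y
  | 0 => hr.y_init
  | t + 1 => (hr.y_step t).1

theorem mem_X (hr : IsRun X Y L Lyy τ β x y) (hX : Convex ℝ X) (hτ : IsStepSize c τ) (t : ℕ) :
    x t ∈ X := by
  induction t with
  | zero => exact hr.x_init
  | succ t ih =>
    obtain ⟨v, hv, e⟩ := hr.x_step t
    rw [e]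
    exact hX.add_smul_sub_mem ih hv.1 ⟨hτ.nonneg t, (hτ t).2.2⟩

theorem norm_step_le (hr : IsRun X Y L Lyy τ β x y) (h : Assumptions X Y L μ Lxx Lyx Lyy DX DY)
    (hτ : IsStepSize c τ) (t : ℕ) : ‖x (t + 1) - x t‖ ≤ c * DX / (t + 1) := by
  obtain ⟨v, hv, e⟩ := hr.x_step t
  rw [e, add_sub_cancel_left, norm_smul, Real.norm_of_nonneg (hτ.nonneg t), mul_div_right_comm]
  exact mul_le_mul (hτ t).2.1 (h.norm_sub_le_X hv.1 (hr.mem_X h.convex_X hτ t)) (norm_nonneg _)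
    ((hτ.nonneg t).trans (hτ t).2.1)

theorem exists_argmax (hr : IsRun X Y L Lyy τ β x y)
    (h : Assumptions X Y L μ Lxx Lyx Lyy DX DY) (hτ : IsStepSize c τ) :
    ∃ u : ℕ → Euc m, ∀ t, u t ∈ Y ∧ IsMaxOn (regPayoff L (y 0) (β t) (x t)) Y (u t) := by
  choose u hu hm using fun t => h.exists_isMaxOn_regPayoff (hr.mem_X h.convex_X hτ t)
    ⟨_, hr.y_init⟩ (y 0) (β t)
  exact ⟨u, fun t => ⟨hu t, hm t⟩⟩

/-- The distance of the dual iterate to the moving maximizer contracts up to the drift. -/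
theorem tracking (hr : IsRun X Y L Lyy τ β x y)
    (h : Assumptions X Y L μ Lxx Lyx Lyy DX DY) (hτ : IsStepSize c τ) {u : ℕ → Euc m}
    (hu : ∀ t, u t ∈ Y ∧ IsMaxOn (regPayoff L (y 0) (β t) (x t)) Y (u t))
    (hβ : Antitone β) (hβ0 : ∀ t, 0 ≤ β t) {σ : ℕ → ℝ} {Λ : ℝ} (hσ0 : ∀ t, 0 < σ t)
    (hσ : ∀ t, σ t ≤ μ + β t) (hΛ : ∀ t, Lyy + β t ≤ Λ) (hσΛ : ∀ t, σ t ≤ Λ) (t : ℕ) :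
    ‖y (t + 1) - u (t + 1)‖ ≤ (1 - σ t / (2 * Λ)) * ‖y t - u t‖
      + (Lyx * (c * DX / (t + 1)) + (β t - β (t + 1)) * DY) / σ (t + 1) := by
  have hx := hr.mem_X h.convex_X hτ
  have h1 := h.contraction (hx t) (hr.mem_Y t) (hu t).1 (hr.y_step t) (hu t).2 (hβ0 t) (hσ0 t)
    (hσ t) (hΛ t) (hσΛ t)
  have h2 := h.norm_sub_argmax_le (hx t) (hx (t + 1)) hr.y_init (hu t).1 (hu (t + 1)).1 (hu t).2
    (hu (t + 1)).2 (hβ t.le_succ) (hσ (t + 1))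
  have h3 := mul_le_mul_of_nonneg_left (hr.norm_step_le h hτ t) h.Lyx_pos.le
  have h4 : ‖u (t + 1) - u t‖
      ≤ (Lyx * (c * DX / (t + 1)) + (β t - β (t + 1)) * DY) / σ (t + 1) := by
    rw [le_div_iff₀ (hσ0 _)]
    linarith
  have h5 := norm_sub_le_norm_sub_add_norm_sub (y (t + 1)) (u t) (u (t + 1))
  rw [norm_sub_rev (u t)] at h5
  linarith

/-- The dual gap after a step, for any maximizer of the payoff at the new primal iterate. -/
theorem dualGap_succ_le (hr : IsRun X Y L Lyy τ β x y)
    (h : Assumptions X Y L μ Lxx Lyx Lyy DX DY) (hτ : IsStepSize c τ) {u : ℕ → Euc m}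
    (hu : ∀ t, u t ∈ Y ∧ IsMaxOn (regPayoff L (y 0) (β t) (x t)) Y (u t))
    (hβ0 : ∀ t, 0 ≤ β t) {σ : ℕ → ℝ} {Λ : ℝ} (hσ0 : ∀ t, 0 < σ t)
    (hσ : ∀ t, σ t ≤ μ + β t) (hΛ : ∀ t, Lyy + β t ≤ Λ) (t : ℕ) {w : Euc m} (hw : w ∈ Y)
    (hwm : IsMaxOn (L (x (t + 1))) Y w) :
    dualGap Y L (x (t + 1)) (y (t + 1)) ≤ Λ / 2 * ‖y t - u t‖ ^ 2 + β t / 2 * DY ^ 2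
      + Lyx * (c * DX / (t + 1)) * ‖y (t + 1) - w‖ := by
  have hx := hr.mem_X h.convex_X hτ
  have h0 : dualGap Y L (x (t + 1)) (y (t + 1)) = L (x (t + 1)) w - L (x (t + 1)) (y (t + 1)) := by
    rw [← primal_eq_of_isMaxOn hw hwm]
    rfl
  -- The ascent step used `x t`, not `x (t + 1)`; the mixed difference pays for the change of `x`.
  have h1 := h.mixed_difference_le (hx t) (hx (t + 1)) (hr.mem_Y (t + 1)) hw
  have h2 := h.ascent_step (hx t) (hr.mem_Y t) (hu t).1 (hr.y_step t) (hβ0 t) (hσ0 t) (hσ t)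
  have h3 : regPayoff L (y 0) (β t) (x t) w ≤ regPayoff L (y 0) (β t) (x t) (u t) := (hu t).2 hw
  have h4 := mul_le_mul_of_nonneg_right
    (mul_le_mul_of_nonneg_left (hr.norm_step_le h hτ t) h.Lyx_pos.le)
    (norm_nonneg (w - y (t + 1)))
  have h5 := mul_le_mul_of_nonneg_left (pow_le_pow_left₀ (norm_nonneg _)
    (h.norm_sub_le_Y hw hr.y_init) 2) (div_nonneg (hβ0 t) zero_le_two)
  have h6 := mul_le_mul_of_nonneg_right (hΛ t) (sq_nonneg ‖u t - y t‖)
  have h7 := mul_nonneg (hσ0 t).le (sq_nonneg ‖u t - y t‖)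
  have h8 := mul_nonneg (add_nonneg h.Lyy_nonneg (hβ0 t)) (sq_nonneg ‖u t - y (t + 1)‖)
  have h9 := mul_nonneg (hβ0 t) (sq_nonneg ‖y (t + 1) - y 0‖)
  rw [h0, norm_sub_rev (y t), norm_sub_rev (y (t + 1)) w]
  have h10 : L (x t) w - L (x t) (y (t + 1))
      ≤ Λ / 2 * ‖u t - y t‖ ^ 2 + β t / 2 * DY ^ 2 := by
    have e3 : L (x t) w - β t / 2 * ‖w - y 0‖ ^ 2 ≤ regPayoff L (y 0) (β t) (x t) (u t) := h3
    have e2 : regPayoff L (y 0) (β t) (x t) (y (t + 1))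
      = L (x t) (y (t + 1)) - β t / 2 * ‖y (t + 1) - y 0‖ ^ 2 := rfl
    linarith
  linarith

/-- Frank-Wolfe steps weighted by `t` telescope. Each decrease of `β` costs at most `(β t - β (t +
1)) * DY ^ 2 / 2`, and the last term is the bias of the final regularization. -/
theorem primalGap_mul_le (hr : IsRun X Y L Lyy τ β x y)
    (h : Assumptions X Y L μ Lxx Lyx Lyy DX DY) (hc : ConvexConcave X Y L)
    (hτ : IsStepSize c τ) {u : ℕ → Euc m}
    (hu : ∀ t, u t ∈ Y ∧ IsMaxOn (regPayoff L (y 0) (β t) (x t)) Y (u t))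
    (hβ : Antitone β) (hβ0 : ∀ t, 0 ≤ β t) {σ : ℕ → ℝ} (hσ0 : ∀ t, 0 < σ t)
    (hσ : ∀ t, σ t ≤ μ + β t) {T : ℕ} (hT : 1 ≤ T) :
    T * primalGap X Y L (x T) ≤ ∑ t ∈ Finset.range T,
      (c * (DX * ((Lxx + Lyx ^ 2 / σ t) * (c * DX / (t + 1)) + 2 * Lyx * ‖y t - u t‖))
        + (t + 1) * (β t - β (t + 1)) * (DY ^ 2 / 2)) + T * β T * (DY ^ 2 / 2) := by
  have hx := hr.mem_X h.convex_X hτ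
  have hc1 := hτ.one_le
  have hDX := h.DX_nonneg
  have hLyx := h.Lyx_pos
  have hLxx := h.Lxx_nonneg
  set E : ℕ → ℝ := fun t =>
    DX * ((Lxx + Lyx ^ 2 / σ t) * (c * DX / (t + 1)) + 2 * Lyx * ‖y t - u t‖)
  set B : ℕ → ℝ := fun t => c * E t + (t + 1) * (β t - β (t + 1)) * (DY ^ 2 / 2)
  have hE : ∀ t, 0 ≤ E t := fun t => by
    have := hσ0 t
    positivity
  have hB : ∀ t, 0 ≤ B t := fun t => by
    have h1 := hE t
    have h2 : 0 ≤ β t - β (t + 1) := sub_nonneg.2 (hβ t.le_succ)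
    positivity
  have hT0 : (0 : ℝ) < T := by exact_mod_cast hT
  suffices hs : ∀ p ∈ X, primal Y L (x T) - primal Y L p
      ≤ (∑ t ∈ Finset.range T, B t + T * β T * (DY ^ 2 / 2)) / T by
    have := primalGap_le (hx T) hs
    rwa [le_div_iff₀ hT0, mul_comm] at this
  intro p hp
  choose w hw hwm using fun t => h.exists_isMaxOn_regPayoff hp ⟨_, hr.y_init⟩ (y 0) (β t)
  have hreg : ∀ q : Euc n, ∀ z ∈ Y, ∀ b : ℝ, 0 ≤ b → b * ‖z - y 0‖ ^ 2 ≤ b * DY ^ 2 :=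
    fun _ z hz b hb => mul_le_mul_of_nonneg_left
      (pow_le_pow_left₀ (norm_nonneg _) (h.norm_sub_le_Y hz hr.y_init) 2) hb
  set H : ℕ → ℝ := fun t =>
    regPayoff L (y 0) (β t) (x t) (u t) - regPayoff L (y 0) (β t) p (w t)
  have key : ∀ t : ℕ, t * H t ≤ ∑ i ∈ Finset.range t, B i := by
    intro t
    induction t with
    | zero => simp
    | succ t ih =>
      obtain ⟨v, hv, e⟩ := hr.x_step t
      -- `u'` belongs to the old `β t` at the new `x (t + 1)`: the primal step is analysed with `β`
      -- frozen, and `β` changes afterwards.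
      obtain ⟨u', hu', hm'⟩ := h.exists_isMaxOn_regPayoff (hx (t + 1)) ⟨_, hr.y_init⟩ (y 0) (β t)
      have h1 := h.frankWolfe_step hc (hx t) (hr.mem_Y t) hp hr.y_init (hu t).1 hu' hv
        (hτ.nonneg t) (hτ t).2.2 e (hu t).2 hm' (hwm t) (hσ0 t) (hσ t)
      have h2 : DX * ((Lxx + Lyx ^ 2 / σ t) * ‖x (t + 1) - x t‖ + 2 * Lyx * ‖y t - u t‖) ≤ E t := by
        have := hr.norm_step_le h hτ t
        have := hσ0 t
        simp only [E]
        gcongr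
      have h3 : H (t + 1) ≤ (regPayoff L (y 0) (β t) (x (t + 1)) u'
          - regPayoff L (y 0) (β t) p (w t)) + (β t - β (t + 1)) * (DY ^ 2 / 2) := by
        have a1 : regPayoff L (y 0) (β t) (x (t + 1)) (u (t + 1))
          ≤ regPayoff L (y 0) (β t) (x (t + 1)) u' := hm' (hu (t + 1)).1
        have a2 : regPayoff L (y 0) (β (t + 1)) p (w t)
          ≤ regPayoff L (y 0) (β (t + 1)) p (w (t + 1)) := hwm (t + 1) (hw t)
        have a3 := hreg p _ (hu (t + 1)).1 _ (sub_nonneg.2 (hβ t.le_succ))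
        have a4 := mul_nonneg (sub_nonneg.2 (hβ t.le_succ)) (sq_nonneg ‖w t - y 0‖)
        simp only [H]
        simp only [regPayoff, Nat.succ_eq_add_one] at a1 a2 a3 a4 ⊢
        linarith
      have ht : (0 : ℝ) < t + 1 := by positivity
      have h4 : ((t : ℝ) + 1) * τ t ≤ c := by
        have := (hτ t).2.1
        rwa [le_div_iff₀ ht, mul_comm] at this
      have h5 : 1 ≤ ((t : ℝ) + 1) * τ t := by
        have := (hτ t).1
        rwa [div_le_iff₀ ht, mul_comm] at this
      -- Here `(t + 1) * (1 - τ t) ≤ t`. As `p` is arbitrary, `H t` may be negative; then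
      -- nonnegativity of the partial sums suffices.
      have h6 : ((t : ℝ) + 1) * ((1 - τ t) * H t) ≤ ∑ i ∈ Finset.range t, B i := by
        have hS : 0 ≤ ∑ i ∈ Finset.range t, B i := Finset.sum_nonneg fun i _ => hB i
        rcases le_total (H t) 0 with h0 | h0
        · exact (mul_nonpos_of_nonneg_of_nonpos ht.le
            (mul_nonpos_of_nonneg_of_nonpos (sub_nonneg.2 (hτ t).2.2) h0)).trans hS
        · refine le_trans ?_ ih
          nlinarith
      have h7 : ((t : ℝ) + 1) * (τ t * (DX * ((Lxx + Lyx ^ 2 / σ t) * ‖x (t + 1) - x t‖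
          + 2 * Lyx * ‖y t - u t‖))) ≤ c * E t := by
        rw [← mul_assoc]
        have := hσ0 t
        exact mul_le_mul h4 h2 (by positivity) (by linarith)
      rw [Finset.sum_range_succ]
      push_cast
      have h8 := mul_le_mul_of_nonneg_left (h3.trans (add_le_add_left h1 _)) ht.le
      have h9 : B t = c * E t + (t + 1) * (β t - β (t + 1)) * (DY ^ 2 / 2) := rfl
      simp only [H] at h6 h8 ⊢
      linarith
  have h1 := key T
  have hx1 : primal Y L (x T) ≤ regPayoff L (y 0) (β T) (x T) (u T) + β T * (DY ^ 2 / 2) := by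
    obtain ⟨a, ha, hm⟩ := h.exists_isMaxOn_regPayoff (hx T) ⟨_, hr.y_init⟩ (y 0) 0
    rw [regPayoff_zero] at hm
    rw [primal_eq_of_isMaxOn ha hm]
    have a1 : regPayoff L (y 0) (β T) (x T) a ≤ regPayoff L (y 0) (β T) (x T) (u T) := (hu T).2 ha
    have a2 := hreg p a ha _ (hβ0 T)
    simp only [regPayoff] at a1 ⊢
    linarith
  have hp1 : regPayoff L (y 0) (β T) p (w T) ≤ primal Y L p := by
    obtain ⟨a, ha, hm⟩ := h.exists_isMaxOn_regPayoff hp ⟨_, hr.y_init⟩ (y 0) 0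
    rw [regPayoff_zero] at hm
    rw [primal_eq_of_isMaxOn ha hm]
    have a1 : L p (w T) ≤ L p a := hm (hw T)
    have a2 := mul_nonneg (hβ0 T) (sq_nonneg ‖w T - y 0‖)
    simp only [regPayoff]
    linarith
  rw [le_div_iff₀ hT0]
  have h2 : primal Y L (x T) - primal Y L p ≤ H T + β T * (DY ^ 2 / 2) := by
    simp only [H]
    linarith
  have h3 := mul_le_mul_of_nonneg_right h2 hT0.le
  linarith

end IsRun

end

/-! ### Elementary sums. -/

section Sums

theorem sum_Icc_one_eq_sum_range (f : ℕ → ℝ) (T : ℕ) :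
    ∑ t ∈ Finset.Icc 1 T, f t = ∑ t ∈ Finset.range T, f (t + 1) := by
  induction T with
  | zero => simp
  | succ T ih => rw [Finset.sum_Icc_succ_top (by omega), Finset.sum_range_succ, ih]

theorem sum_one_div_le_one_add_log (T : ℕ) :
    ∑ t ∈ Finset.range T, 1 / ((t : ℝ) + 1) ≤ 1 + Real.log T := by
  have := harmonic_le_one_add_log T
  simpa [harmonic] using this

theorem sum_one_div_sq_le_two (T : ℕ) :
    ∑ t ∈ Finset.range T, (1 / ((t : ℝ) + 1)) ^ 2 ≤ 2 := by
  suffices h : ∑ t ∈ Finset.range T, (1 / ((t : ℝ) + 1)) ^ 2 ≤ (2 - 1 / T : ℝ) from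
    h.trans (sub_le_self _ (by positivity))
  induction T with
  | zero => norm_num
  | succ T ih =>
    rw [Finset.sum_range_succ]
    -- In `2 - 1 / T` the default `1 / 0 = 0` makes the first step exceptional.
    rcases T.eq_zero_or_pos with rfl | hT
    · norm_num
    have hT0 : (0 : ℝ) < T := by exact_mod_cast hT
    have h1 : (1 / ((T : ℝ) + 1)) ^ 2 ≤ 1 / T - 1 / (T + 1) := by
      rw [div_sub_div _ _ hT0.ne' (by positivity), div_pow,
        div_le_div_iff₀ (by positivity) (by positivity)]
      nlinarith
    push_cast
    linarith

/-- A positive real has a positive cube root, whose inverse is the power `-1/3`. -/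
theorem exists_cube_root (a : ℝ) (ha : 0 < a) :
    ∃ r : ℝ, 0 < r ∧ r ^ 3 = a ∧ a ^ (-(1 / 3) : ℝ) = r⁻¹ := by
  refine ⟨a ^ (1 / 3 : ℝ), by positivity, ?_, Real.rpow_neg ha.le _⟩
  rw [← Real.rpow_natCast, ← Real.rpow_mul ha.le]
  norm_num

theorem sum_rpow_neg_third_le (T : ℕ) :
    ∑ t ∈ Finset.range T, ((t : ℝ) + 1) ^ (-(1 / 3) : ℝ)
      ≤ 3 / 2 * (T * (T : ℝ) ^ (-(1 / 3) : ℝ)) := by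
  induction T with
  | zero => simp
  | succ T ih =>
    rw [Finset.sum_range_succ]
    push_cast
    obtain ⟨a, ha, ha3, e⟩ := exists_cube_root ((T : ℝ) + 1) (by positivity)
    rcases T.eq_zero_or_pos with rfl | hT
    · norm_num
    obtain ⟨b, hb, hb3, e'⟩ := exists_cube_root (T : ℝ) (by exact_mod_cast hT)
    rw [e'] at ih
    rw [e]
    have e1 : (T : ℝ) * b⁻¹ = b ^ 2 := by rw [← hb3]; field_simp
    have e2 : ((T : ℝ) + 1) * a⁻¹ = a ^ 2 := by rw [← ha3]; field_simp
    rw [e1] at ih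
    rw [e2]
    -- With `a ^ 3 - b ^ 3 = 1` this is `0 ≤ a ^ 3 - 3 * a * b ^ 2 + 2 * b ^ 3 = (a - b) ^ 2 * (a +
    -- 2 * b)`.
    have h1 : a⁻¹ ≤ 3 / 2 * (a ^ 2 - b ^ 2) := by
      rw [inv_le_iff_one_le_mul₀ ha]
      nlinarith [mul_nonneg (sq_nonneg (a - b)) (by positivity : 0 ≤ a + 2 * b)]
    linarith

theorem one_div_le_rpow_neg_third (t : ℕ) :
    1 / ((t : ℝ) + 1) ≤ ((t : ℝ) + 1) ^ (-(1 / 3) : ℝ) := by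
  rw [one_div, ← Real.rpow_neg_one]
  exact Real.rpow_le_rpow_of_exponent_le (by linarith [t.cast_nonneg (α := ℝ)]) (by norm_num)

theorem rpow_neg_third_le_one (t : ℕ) : ((t : ℝ) + 1) ^ (-(1 / 3) : ℝ) ≤ 1 :=
  Real.rpow_le_one_of_one_le_of_nonpos (by linarith [t.cast_nonneg (α := ℝ)]) (by norm_num)

end Sums

/-! ### Contraction recursions with drift. -/

section Recursions

variable {d : ℕ → ℝ} {a C D : ℝ}

theorem sum_le_of_geometric_drift (ha : 0 < a) (hd : ∀ t, 0 ≤ d t) (hD : ∀ t, d t ≤ D)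
    (hC : 0 ≤ C) (h : ∀ t : ℕ, d (t + 1) ≤ (1 - a) * d t + C * (1 / ((t : ℝ) + 1))) (T : ℕ) :
    ∑ t ∈ Finset.range T, d t ≤ (D + C * (1 + Real.log T)) / a := by
  rw [le_div_iff₀ ha, mul_comm]
  have h1 : ∑ t ∈ Finset.range T, a * d t
      ≤ ∑ t ∈ Finset.range T, ((d t - d (t + 1)) + C * (1 / ((t : ℝ) + 1))) :=
    Finset.sum_le_sum fun t _ => by linarith [h t]
  rw [Finset.sum_add_distrib, Finset.sum_range_sub', ← Finset.mul_sum, ← Finset.mul_sum] at h1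
  have h2 := mul_le_mul_of_nonneg_left (sum_one_div_le_one_add_log T) hC
  linarith [hd T, hD 0]

theorem sum_sq_le_of_geometric_drift (ha : 0 < a) (ha1 : a ≤ 1) (hd : ∀ t, 0 ≤ d t)
    (hD : ∀ t, d t ≤ D)
    (h : ∀ t : ℕ, d (t + 1) ≤ (1 - a) * d t + C * (1 / ((t : ℝ) + 1))) (T : ℕ) :
    ∑ t ∈ Finset.range T, d t ^ 2 ≤ (D ^ 2 + C ^ 2 / a * 2) / a := by
  rw [le_div_iff₀ ha, mul_comm]
  have h1 : ∑ t ∈ Finset.range T, a * d t ^ 2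
      ≤ ∑ t ∈ Finset.range T, ((d t ^ 2 - d (t + 1) ^ 2) + C ^ 2 / a * (1 / ((t : ℝ) + 1)) ^ 2) := by
    refine Finset.sum_le_sum fun t _ => ?_
    set e := C * (1 / ((t : ℝ) + 1)) with he
    have hC2 : C ^ 2 / a * (1 / ((t : ℝ) + 1)) ^ 2 = e ^ 2 / a := by rw [he]; ring
    rw [hC2]
    have h2 := pow_le_pow_left₀ (hd (t + 1)) (h t) 2
    -- Convexity of the square for `(1 - a) * d t + a * (e / a)`.
    have h3 : ((1 - a) * d t + e) ^ 2 ≤ (1 - a) * d t ^ 2 + e ^ 2 / a := by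
      have : (1 - a) * d t ^ 2 + e ^ 2 / a - ((1 - a) * d t + e) ^ 2
          = (1 - a) * (a * d t - e) ^ 2 / a := by
        field_simp
        ring
      have h4 : 0 ≤ (1 - a) * (a * d t - e) ^ 2 / a :=
        div_nonneg (mul_nonneg (sub_nonneg.2 ha1) (sq_nonneg _)) ha.le
      linarith
    linarith
  rw [Finset.sum_add_distrib, Finset.sum_range_sub' (fun t => d t ^ 2), ← Finset.mul_sum,
    ← Finset.mul_sum] at h1
  have h2 := mul_le_mul_of_nonneg_left (sum_one_div_sq_le_two T) (by positivity : 0 ≤ C ^ 2 / a)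
  have h3 := pow_le_pow_left₀ (hd 0) (hD 0) 2
  linarith [sq_nonneg (d T)]

/-- Dividing the recursion by `β t` turns the vanishing contraction rate into the constant `κ`. The
changes of `1 / β` that this creates, and those from the drift of `β`, are each at most `D * (1 / β
(t + 1) - 1 / β t)`, so they telescope through the shift `d - 2 * D`. -/
theorem sum_le_of_smoothed_drift {β : ℕ → ℝ} {c₁ c₂ κ : ℝ} (hκ : 0 < κ) (hc₁ : 0 < c₁)
    (hβ : IsSmoothing (1 / 3) c₁ c₂ β) (hd : ∀ t, 0 ≤ d t) (hD : ∀ t, d t ≤ D) (hC : 0 ≤ C)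
    (h : ∀ t : ℕ, d (t + 1) ≤ (1 - κ * β t) * d t
      + (C / ((t : ℝ) + 1) + (β t - β (t + 1)) * D) / β (t + 1)) {T : ℕ} (hT : 1 ≤ T) :
    ∑ t ∈ Finset.range T, d t
      ≤ (4 * D / c₁ + 3 * C / c₁ ^ 2) / κ * (T * (T : ℝ) ^ (-(1 / 3) : ℝ)) := by
  have hb : ∀ t, 0 < β t := fun t =>
    lt_of_lt_of_le (by positivity) (hβ.2 t).1
  have hD0 : 0 ≤ D := (hd 0).trans (hD 0)
  have hterm : ∀ t : ℕ, C / (((t : ℝ) + 1) * (β t * β (t + 1)))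
      ≤ 2 * C / c₁ ^ 2 * ((t : ℝ) + 1) ^ (-(1 / 3) : ℝ) := by
    intro t
    obtain ⟨r, hr, hr3, e⟩ := exists_cube_root ((t : ℝ) + 1) (by positivity)
    obtain ⟨q, hq, hq3, e'⟩ := exists_cube_root ((t : ℝ) + 1 + 1) (by positivity)
    have h1 := (hβ.2 t).1
    have h2 := (hβ.2 (t + 1)).1
    push_cast at h2
    rw [e] at h1 ⊢
    rw [e'] at h2
    -- Crude form of `t + 2 ≤ 8 * (t + 1)`.
    have h3 : q ≤ 2 * r := by
      refine le_of_pow_le_pow_left₀ three_ne_zero (by positivity) ?_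
      rw [mul_pow, hq3, hr3]
      linarith [t.cast_nonneg (α := ℝ)]
    have h4 : (c₁ * r⁻¹) * (c₁ * q⁻¹) ≤ β t * β (t + 1) :=
      mul_le_mul h1 h2 (by positivity) (hb t).le
    have h5 : c₁ ^ 2 * r / 2 ≤ r ^ 3 * (β t * β (t + 1)) := by
      refine le_trans ?_ (mul_le_mul_of_nonneg_left h4 (by positivity))
      have : r ^ 3 * ((c₁ * r⁻¹) * (c₁ * q⁻¹)) = c₁ ^ 2 * (r ^ 2 / q) := by field_simp
      rw [this, mul_div_assoc]
      refine mul_le_mul_of_nonneg_left ?_ (by positivity)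
      rw [div_le_div_iff₀ two_pos hq]
      nlinarith
    rw [← hr3]
    calc C / (r ^ 3 * (β t * β (t + 1))) ≤ C / (c₁ ^ 2 * r / 2) :=
          div_le_div_of_nonneg_left hC (by positivity) h5
      _ = 2 * C / c₁ ^ 2 * r⁻¹ := by field_simp
  have hlast : 1 / β T ≤ 2 / c₁ * (T * (T : ℝ) ^ (-(1 / 3) : ℝ)) := by
    have hT1 : (1 : ℝ) ≤ T := by exact_mod_cast hT
    obtain ⟨q, hq, hq3, e⟩ := exists_cube_root ((T : ℝ) + 1) (by positivity)
    obtain ⟨r, hr, hr3, e'⟩ := exists_cube_root (T : ℝ) (by positivity)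
    have h1 := (hβ.2 T).1
    rw [e] at h1
    have h4 : (T : ℝ) * r⁻¹ = r ^ 2 := by rw [← hr3]; field_simp
    have hr1 : 1 ≤ r := by
      refine le_of_pow_le_pow_left₀ three_ne_zero hr.le ?_
      rwa [one_pow, hr3]
    have h3 : q ≤ 2 * r ^ 2 := by
      refine le_of_pow_le_pow_left₀ three_ne_zero (by positivity) ?_
      rw [mul_pow, ← pow_mul, mul_comm 2 3, pow_mul, hq3, hr3]
      nlinarith
    rw [e', h4]
    calc 1 / β T ≤ 1 / (c₁ * q⁻¹) := one_div_le_one_div_of_le (by positivity) h1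
      _ = 1 / c₁ * q := by field_simp
      _ ≤ 1 / c₁ * (2 * r ^ 2) := mul_le_mul_of_nonneg_left h3 (by positivity)
      _ = 2 / c₁ * r ^ 2 := by ring
  have hstep : ∀ t : ℕ, κ * d t ≤ ((d t - 2 * D) / β t - (d (t + 1) - 2 * D) / β (t + 1))
      + 2 * C / c₁ ^ 2 * ((t : ℝ) + 1) ^ (-(1 / 3) : ℝ) := by
    intro t
    refine le_trans ?_ (add_le_add_right (hterm t) _)
    have hb0 := hb t
    have hb1 := hb (t + 1)
    have h1 : κ * β t * d t ≤ d t - d (t + 1)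
      + (C / ((t : ℝ) + 1) + (β t - β (t + 1)) * D) / β (t + 1) := by linarith [h t]
    have h2 : κ * d t ≤ (d t - d (t + 1)
      + (C / ((t : ℝ) + 1) + (β t - β (t + 1)) * D) / β (t + 1)) / β t := by
      rw [le_div_iff₀ hb0]
      linarith
    have h3 : (d t - 2 * D) / β t - (d (t + 1) - 2 * D) / β (t + 1)
        + C / (((t : ℝ) + 1) * (β t * β (t + 1)))
        - (d t - d (t + 1) + (C / ((t : ℝ) + 1) + (β t - β (t + 1)) * D) / β (t + 1)) / β t
        = (D - d (t + 1)) * (β t - β (t + 1)) / (β t * β (t + 1)) := by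
      field_simp
      ring
    have h4 : 0 ≤ (D - d (t + 1)) * (β t - β (t + 1)) / (β t * β (t + 1)) :=
      div_nonneg (mul_nonneg (sub_nonneg.2 (hD _)) (sub_nonneg.2 (hβ.1 t.le_succ)))
        (by positivity)
    linarith
  have hsum := Finset.sum_le_sum fun t (_ : t ∈ Finset.range T) => hstep t
  rw [Finset.sum_add_distrib, Finset.sum_range_sub' (fun t => (d t - 2 * D) / β t),
    ← Finset.mul_sum, ← Finset.mul_sum] at hsum
  have h5 : (d 0 - 2 * D) / β 0 ≤ 0 :=
    div_nonpos_of_nonpos_of_nonneg (by linarith [hD 0]) (hb 0).le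
  have h6 : -(2 * D * (1 / β T)) ≤ (d T - 2 * D) / β T := by
    rw [sub_div, mul_one_div]
    linarith [div_nonneg (hd T) (hb T).le]
  have h7 := mul_le_mul_of_nonneg_left hlast (by positivity : 0 ≤ 2 * D)
  have h8 := mul_le_mul_of_nonneg_left (sum_rpow_neg_third_le T)
    (by positivity : 0 ≤ 2 * C / c₁ ^ 2)
  rw [div_mul_eq_mul_div, le_div_iff₀ hκ]
  have e : (4 * D / c₁ + 3 * C / c₁ ^ 2) * (T * (T : ℝ) ^ (-(1 / 3) : ℝ))
      = 2 * D * (2 / c₁ * (T * (T : ℝ) ^ (-(1 / 3) : ℝ)))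
        + 2 * C / c₁ ^ 2 * (3 / 2 * (T * (T : ℝ) ^ (-(1 / 3) : ℝ))) := by ring
  rw [e]
  linarith

end Recursions

/-! ### The two rates. -/

section

variable {n m : ℕ} {X : Set (Euc n)} {Y : Set (Euc m)} {L : Euc n → Euc m → ℝ}
  {μ Lxx Lyx Lyy DX DY : ℝ} {c : ℝ} {τ β : ℕ → ℝ} {x : ℕ → Euc n} {y : ℕ → Euc m}

theorem IsRun.convexConcave_rate (hr : IsRun X Y L Lyy τ β x y)
    (h : Assumptions X Y L μ Lxx Lyx Lyy DX DY) (hc : ConvexConcave X Y L)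
    (hτ : IsStepSize c τ) {c₁ c₂ : ℝ} (hc₁ : 0 < c₁) (hβ : IsSmoothing (1 / 3) c₁ c₂ β)
    {S : ℝ} (hS : S = (4 * DY / c₁ + 3 * (Lyx * (c * DX)) / c₁ ^ 2) / (1 / (2 * (Lyy + c₂))))
    {T : ℕ} (hT : 1 ≤ T) :
    0 ≤ S ∧ 0 < c₂ ∧
    T * primalGap X Y L (x T) ≤ (c * (DX * ((Lxx + Lyx ^ 2 / c₁) * (c * DX) * (3 / 2)
        + 2 * Lyx * S)) + c₂ * (DY ^ 2 / 2) * (3 / 2)) * (T * (T : ℝ) ^ (-(1 / 3) : ℝ)) ∧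
    ∑ t ∈ Finset.Icc 1 T, dualGap Y L (x t) (y t) ≤
      ((Lyy + c₂) / 2 * DY * S + (c₂ / 2 * DY ^ 2 + Lyx * (c * DX) * DY) * (3 / 2))
        * (T * (T : ℝ) ^ (-(1 / 3) : ℝ)) := by
  have hDX := h.DX_nonneg
  have hDY := h.DY_nonneg
  have hLyx := h.Lyx_pos
  have hLxx := h.Lxx_nonneg
  have hLyy := h.Lyy_nonneg
  have hμ := h.mu_nonneg
  have hc0 : 0 < c := one_pos.trans_le hτ.one_le
  have hb : ∀ t, 0 < β t := fun t => lt_of_lt_of_le (by positivity) (hβ.2 t).1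
  have hc₂ : 0 < c₂ := by
    have := (hb 0).trans_le (hβ.2 0).2
    simpa using this
  have hb2 : ∀ t, β t ≤ c₂ := fun t =>
    (hβ.2 t).2.trans (mul_le_of_le_one_right hc₂.le (rpow_neg_third_le_one t))
  have hS0 : 0 ≤ S := by rw [hS]; positivity
  obtain ⟨u, hu⟩ := hr.exists_argmax h hτ
  have hd : ∀ t, ‖y t - u t‖ ≤ DY := fun t => h.norm_sub_le_Y (hr.mem_Y t) (hu t).1
  have hσ : ∀ t, β t ≤ μ + β t := fun t => by linarith
  have hΛ : ∀ t, Lyy + β t ≤ Lyy + c₂ := fun t => by linarith [hb2 t]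
  have hsum : ∑ t ∈ Finset.range T, ‖y t - u t‖ ≤ S * (T * (T : ℝ) ^ (-(1 / 3) : ℝ)) := by
    rw [hS]
    refine sum_le_of_smoothed_drift (d := fun t => ‖y t - u t‖) (by positivity) hc₁ hβ
      (fun t => norm_nonneg _) hd (by positivity) (fun t => ?_) hT
    have := hr.tracking h hτ hu hβ.1 (fun t => (hb t).le) hb hσ hΛ
      (fun t => by linarith [hb2 t]) t
    rwa [mul_div_assoc', ← one_div_mul_eq_div] at this
  have hw := sum_rpow_neg_third_le T
  have hβw : ∑ t ∈ Finset.range T, β t ≤ c₂ * (3 / 2 * (T * (T : ℝ) ^ (-(1 / 3) : ℝ))) := by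
    refine (Finset.sum_le_sum fun t _ => (hβ.2 t).2).trans ?_
    rw [← Finset.mul_sum]
    exact mul_le_mul_of_nonneg_left hw hc₂.le
  refine ⟨hS0, hc₂, ?_, ?_⟩
  · refine (hr.primalGap_mul_le h hc hτ hu hβ.1 (fun t => (hb t).le) hb hσ hT).trans ?_
    -- The curvature term is of order `(t + 1) ^ (-2 / 3)`, below the target order.
    have hterm : ∀ t : ℕ, (Lxx + Lyx ^ 2 / β t) * (c * DX / (t + 1))
        ≤ (Lxx + Lyx ^ 2 / c₁) * (c * DX) * ((t : ℝ) + 1) ^ (-(1 / 3) : ℝ) := by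
      intro t
      have hone := one_div_le_rpow_neg_third t
      obtain ⟨r, hr, hr3, e⟩ := exists_cube_root ((t : ℝ) + 1) (by positivity)
      have h1 := (hβ.2 t).1
      rw [e] at h1 hone ⊢
      have hr1 : 1 ≤ r := by
        refine le_of_pow_le_pow_left₀ three_ne_zero hr.le ?_
        rw [hr3]
        linarith [t.cast_nonneg (α := ℝ)]
      have h2 : 1 / (β t * (t + 1)) ≤ 1 / c₁ * r⁻¹ := by
        rw [← one_div, one_div_mul_one_div]
        refine one_div_le_one_div_of_le (by positivity) ?_
        rw [← hr3]
        have h3 := mul_le_mul_of_nonneg_right h1 (by positivity : 0 ≤ r ^ 3)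
        have h4 : c₁ * r⁻¹ * r ^ 3 = c₁ * r * r := by field_simp
        have h5 : c₁ * r * 1 ≤ c₁ * r * r := mul_le_mul_of_nonneg_left hr1 (by positivity)
        linarith
      have e1 : (Lxx + Lyx ^ 2 / β t) * (c * DX / (t + 1))
          = c * DX * (Lxx * (1 / (t + 1)) + Lyx ^ 2 * (1 / (β t * (t + 1)))) := by
        have := hb t
        field_simp
      have e2 : (Lxx + Lyx ^ 2 / c₁) * (c * DX) * r⁻¹
          = c * DX * (Lxx * r⁻¹ + Lyx ^ 2 * (1 / c₁ * r⁻¹)) := by ring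
      rw [e1, e2]
      gcongr
    -- Summation by parts: `-T * β T` cancels the final bias exactly, and no bound on the individual
    -- decrements of `β` is needed.
    have hβtel : ∑ t ∈ Finset.range T, ((t : ℝ) + 1) * (β t - β (t + 1))
        = ∑ t ∈ Finset.range T, β t - T * β T := by
      have h1 := Finset.sum_range_sub' (fun t : ℕ => (t : ℝ) * β t) T
      simp only [Nat.cast_zero, zero_mul, zero_sub] at h1
      rw [sub_eq_add_neg, ← h1, ← Finset.sum_add_distrib]
      refine Finset.sum_congr rfl fun t _ => ?_
      push_cast
      ring
    rw [Finset.sum_add_distrib, ← Finset.sum_mul, hβtel, ← Finset.mul_sum, ← Finset.mul_sum,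
      Finset.sum_add_distrib, ← Finset.mul_sum (f := fun t => ‖y t - u t‖)]
    have h1 := Finset.sum_le_sum fun t (_ : t ∈ Finset.range T) => hterm t
    rw [← Finset.mul_sum] at h1
    have h2 := h1.trans (mul_le_mul_of_nonneg_left hw (by positivity))
    have h3 := mul_le_mul_of_nonneg_left hsum (by positivity : 0 ≤ 2 * Lyx)
    have h4 := mul_le_mul_of_nonneg_left (mul_le_mul_of_nonneg_left (add_le_add h2 h3) hDX) hc0.le
    have h5 := mul_le_mul_of_nonneg_right hβw (by positivity : 0 ≤ DY ^ 2 / 2)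
    linarith
  · rw [sum_Icc_one_eq_sum_range]
    have hterm : ∀ t, dualGap Y L (x (t + 1)) (y (t + 1))
        ≤ (Lyy + c₂) / 2 * DY * ‖y t - u t‖
          + (c₂ / 2 * DY ^ 2 + Lyx * (c * DX) * DY) * ((t : ℝ) + 1) ^ (-(1 / 3) : ℝ) := by
      intro t
      obtain ⟨w, hw, hwm⟩ := h.exists_isMaxOn_regPayoff (hr.mem_X h.convex_X hτ (t + 1))
        ⟨_, hr.y_init⟩ (y 0) 0
      rw [regPayoff_zero] at hwm
      have h1 := hr.dualGap_succ_le h hτ hu (fun t => (hb t).le) hb hσ hΛ t hw hwm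
      have h2 : ‖y t - u t‖ ^ 2 ≤ DY * ‖y t - u t‖ := by
        rw [sq]
        exact mul_le_mul_of_nonneg_right (hd t) (norm_nonneg _)
      have h3 := mul_le_mul_of_nonneg_left h2 (by positivity : 0 ≤ (Lyy + c₂) / 2)
      have h4 := mul_le_mul_of_nonneg_right (hβ.2 t).2 (by positivity : 0 ≤ DY ^ 2 / 2)
      have h5 : Lyx * (c * DX / (t + 1)) * ‖y (t + 1) - w‖
          ≤ Lyx * (c * DX * ((t : ℝ) + 1) ^ (-(1 / 3) : ℝ)) * DY := by
        have a1 := one_div_le_rpow_neg_third t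
        have a2 := h.norm_sub_le_Y (hr.mem_Y (t + 1)) hw
        rw [← mul_one_div]
        gcongr
      linarith
    refine (Finset.sum_le_sum fun t _ => hterm t).trans ?_
    rw [Finset.sum_add_distrib, ← Finset.mul_sum, ← Finset.mul_sum]
    have h1 := mul_le_mul_of_nonneg_left hsum (by positivity : 0 ≤ (Lyy + c₂) / 2 * DY)
    have h2 := mul_le_mul_of_nonneg_left hw
      (by positivity : 0 ≤ c₂ / 2 * DY ^ 2 + Lyx * (c * DX) * DY)
    linarith

theorem IsRun.convexStronglyConcave_rate (hr : IsRun X Y L Lyy τ (fun _ => 0) x y)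
    (h : Assumptions X Y L μ Lxx Lyx Lyy DX DY) (hc : ConvexConcave X Y L)
    (hτ : IsStepSize c τ) (hμ : 0 < μ) {a C S : ℝ} (ha : a = μ / (2 * (Lyy + μ)))
    (hC : C = Lyx * (c * DX) / μ) (hS : S = (DY ^ 2 + C ^ 2 / a * 2) / a)
    {T : ℕ} (hT : 1 ≤ T) :
    0 < a ∧ 0 ≤ C ∧ 0 ≤ S ∧
    T * primalGap X Y L (x T) ≤ c * (DX * ((Lxx + Lyx ^ 2 / μ) * (c * DX)
        + 2 * Lyx * ((DY + C) / a))) * (1 + Real.log T) ∧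
    ∑ t ∈ Finset.Icc 1 T, dualGap Y L (x t) (y t) ≤
      (Lyy + μ) / 2 * S + Lyx * (c * DX) * ((2 + S) / 2) := by
  have hDX := h.DX_nonneg
  have hDY := h.DY_nonneg
  have hLyx := h.Lyx_pos
  have hLxx := h.Lxx_nonneg
  have hLyy := h.Lyy_nonneg
  have hc0 : 0 < c := one_pos.trans_le hτ.one_le
  have ha0 : 0 < a := by rw [ha]; positivity
  have ha1 : a ≤ 1 := by
    rw [ha, div_le_one (by positivity)]
    linarith
  have hC0 : 0 ≤ C := by rw [hC]; positivity
  have hS0 : 0 ≤ S := by rw [hS]; positivity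
  obtain ⟨u, hu⟩ := hr.exists_argmax h hτ
  have hd : ∀ t, ‖y t - u t‖ ≤ DY := fun t => h.norm_sub_le_Y (hr.mem_Y t) (hu t).1
  have hσ : ∀ t : ℕ, (fun _ => μ) t ≤ μ + (fun _ : ℕ => (0 : ℝ)) t := fun t => by simp
  -- `Λ = Lyy + μ` instead of `Lyy`, because `μ ≤ Lyy` can fail when `Y` is a single point.
  have hΛ : ∀ t, Lyy + (fun _ : ℕ => (0 : ℝ)) t ≤ Lyy + μ := fun t => by simpa using hμ.le
  have hrec : ∀ t : ℕ, ‖y (t + 1) - u (t + 1)‖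
      ≤ (1 - a) * ‖y t - u t‖ + C * (1 / ((t : ℝ) + 1)) := by
    intro t
    have := hr.tracking h hτ hu antitone_const (fun _ => le_rfl) (fun _ => hμ) hσ hΛ
      (fun _ => by simpa using hLyy) t
    rw [ha, hC]
    refine this.trans_eq ?_
    ring
  refine ⟨ha0, hC0, hS0, ?_, ?_⟩
  · refine (hr.primalGap_mul_le h hc hτ hu antitone_const (fun _ => le_rfl) (fun _ => hμ)
      hσ hT).trans ?_
    have h1 := sum_le_of_geometric_drift ha0 (fun t => norm_nonneg (y t - u t)) hd hC0 hrec T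
    have hlog : 0 ≤ Real.log T := Real.log_natCast_nonneg T
    have h2 : (DY + C * (1 + Real.log T)) / a ≤ (DY + C) / a * (1 + Real.log T) := by
      rw [div_mul_eq_mul_div]
      refine div_le_div_of_nonneg_right ?_ ha0.le
      nlinarith [mul_nonneg hDY hlog]
    have h3 := mul_le_mul_of_nonneg_left (h1.trans h2) (by positivity : 0 ≤ 2 * Lyx)
    have h4 := mul_le_mul_of_nonneg_left (sum_one_div_le_one_add_log T)
      (by positivity : 0 ≤ (Lxx + Lyx ^ 2 / μ) * (c * DX))
    have h5 := mul_le_mul_of_nonneg_left (mul_le_mul_of_nonneg_left (add_le_add h4 h3) hDX) hc0.le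
    simp only [sub_self, mul_zero, zero_mul, add_zero]
    rw [← Finset.mul_sum, ← Finset.mul_sum, Finset.sum_add_distrib, ← Finset.mul_sum,
      ← Finset.mul_sum (f := fun t => ‖y t - u t‖)]
    rw [Finset.mul_sum] at h5
    simp only [mul_assoc, mul_one_div] at h5 ⊢
    simp only [div_eq_mul_inv, ← Finset.mul_sum] at h5 ⊢
    linarith
  · rw [sum_Icc_one_eq_sum_range]
    have hterm : ∀ t : ℕ, dualGap Y L (x (t + 1)) (y (t + 1))
        ≤ (Lyy + μ) / 2 * ‖y t - u t‖ ^ 2 + Lyx * (c * DX) / 2 * ((1 / ((t : ℝ) + 1)) ^ 2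
          + ‖y (t + 1) - u (t + 1)‖ ^ 2) := by
      intro t
      -- With `β = 0` the point `u (t + 1)` maximizes the payoff itself, so the cross term is a
      -- product of two square-summable sequences and yields no logarithm.
      have hm := (hu (t + 1)).2
      rw [regPayoff_zero] at hm
      have h1 := hr.dualGap_succ_le h hτ hu (fun _ => le_rfl) (fun _ => hμ) hσ hΛ t
        (hu (t + 1)).1 hm
      have h2 := mul_le_mul_of_nonneg_left (two_mul_le_add_sq (1 / ((t : ℝ) + 1))
        ‖y (t + 1) - u (t + 1)‖) (by positivity : 0 ≤ Lyx * (c * DX) / 2)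
      rw [← mul_one_div (c * DX)] at h1
      linarith
    refine (Finset.sum_le_sum fun t _ => hterm t).trans ?_
    rw [Finset.sum_add_distrib, ← Finset.mul_sum, ← Finset.mul_sum, Finset.sum_add_distrib]
    have hsq := sum_sq_le_of_geometric_drift ha0 ha1 (fun t => norm_nonneg (y t - u t)) hd hrec
    rw [← hS] at hsq
    have h1 := mul_le_mul_of_nonneg_left (hsq T) (by positivity : 0 ≤ (Lyy + μ) / 2)
    -- The cross terms involve `d (t + 1)`, so the sum up to `T + 1` is used and `d 0 ^ 2` dropped.
    have h2 := hsq (T + 1)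
    rw [Finset.sum_range_succ'] at h2
    have h3 := mul_le_mul_of_nonneg_left (add_le_add (sum_one_div_sq_le_two T)
      ((le_add_of_nonneg_right (sq_nonneg _)).trans h2))
      (by positivity : 0 ≤ Lyx * (c * DX) / 2)
    linarith

/-- Dividing summed bounds of order `T * r` by `T`, with a common constant. -/
theorem div_bounds {G A K₁ K₂ r l : ℝ} {T : ℕ} (hT : 1 ≤ T) (hl : 0 ≤ l) (hr : 0 ≤ r)
    (hK₁ : 0 ≤ K₁) (hK₂ : 0 ≤ K₂) (hG : T * G ≤ K₁ * l * (T * r)) (hA : A ≤ K₂ * (T * r)) :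
    G ≤ (K₁ + K₂) * l * r ∧ 1 / (T : ℝ) * A ≤ (K₁ + K₂) * r := by
  have hT0 : (0 : ℝ) < T := by exact_mod_cast hT
  constructor
  · refine le_of_mul_le_mul_left ?_ hT0
    have := mul_nonneg (mul_nonneg hK₂ hl) (mul_nonneg hT0.le hr)
    linarith
  · rw [one_div_mul_eq_div, div_le_iff₀ hT0]
    have := mul_nonneg hK₁ (mul_nonneg hT0.le hr)
    linarith

end

end SaddleLMOPO

theorem theorem4 :
    -- convex-concave case
    (∃ k : ℕ, ∀ μ Lxx Lyx Lyy DX DY c c₁ c₂ : ℝ, 0 < c₁ → ∃ K : ℝ,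
      ∀ (n m : ℕ) (X : Set (SaddleLMOPO.Euc n)) (Y : Set (SaddleLMOPO.Euc m))
        (L : SaddleLMOPO.Euc n → SaddleLMOPO.Euc m → ℝ) (τ β : ℕ → ℝ)
        (x : ℕ → SaddleLMOPO.Euc n) (y : ℕ → SaddleLMOPO.Euc m),
        SaddleLMOPO.Assumptions X Y L μ Lxx Lyx Lyy DX DY →
        SaddleLMOPO.ConvexConcave X Y L →
        SaddleLMOPO.IsStepSize c τ →
        SaddleLMOPO.IsSmoothing (1 / 3) c₁ c₂ β →
        SaddleLMOPO.IsRun X Y L Lyy τ β x y →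
        ∀ T : ℕ, 1 ≤ T →
          SaddleLMOPO.primalGap X Y L (x T)
              ≤ K * (1 + Real.log (T : ℝ)) ^ k * (T : ℝ) ^ (-(1 / 3) : ℝ) ∧
          (1 / (T : ℝ)) * ∑ t ∈ Finset.Icc 1 T, SaddleLMOPO.dualGap Y L (x t) (y t)
              ≤ K * (T : ℝ) ^ (-(1 / 3) : ℝ)) ∧
    -- convex-strongly concave case
    (∃ k : ℕ, ∀ μ Lxx Lyx Lyy DX DY c : ℝ, 0 < μ → ∃ K : ℝ,
      ∀ (n m : ℕ) (X : Set (SaddleLMOPO.Euc n)) (Y : Set (SaddleLMOPO.Euc m))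
        (L : SaddleLMOPO.Euc n → SaddleLMOPO.Euc m → ℝ) (τ : ℕ → ℝ)
        (x : ℕ → SaddleLMOPO.Euc n) (y : ℕ → SaddleLMOPO.Euc m),
        SaddleLMOPO.Assumptions X Y L μ Lxx Lyx Lyy DX DY →
        SaddleLMOPO.ConvexConcave X Y L →
        SaddleLMOPO.IsStepSize c τ →
        SaddleLMOPO.IsRun X Y L Lyy τ (fun _ => 0) x y →
        ∀ T : ℕ, 1 ≤ T →
          SaddleLMOPO.primalGap X Y L (x T)
              ≤ K * (1 + Real.log (T : ℝ)) ^ k * (T : ℝ) ^ (-1 : ℝ) ∧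
          (1 / (T : ℝ)) * ∑ t ∈ Finset.Icc 1 T, SaddleLMOPO.dualGap Y L (x t) (y t)
              ≤ K * (T : ℝ) ^ (-1 : ℝ)) := by
  constructor
  · refine ⟨0, fun μ Lxx Lyx Lyy DX DY c c₁ c₂ hc₁ => ?_⟩
    obtain ⟨S, hS⟩ : ∃ S : ℝ, S = (4 * DY / c₁ + 3 * (Lyx * (c * DX)) / c₁ ^ 2)
      / (1 / (2 * (Lyy + c₂))) := ⟨_, rfl⟩
    refine ⟨(c * (DX * ((Lxx + Lyx ^ 2 / c₁) * (c * DX) * (3 / 2) + 2 * Lyx * S))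
        + c₂ * (DY ^ 2 / 2) * (3 / 2))
      + ((Lyy + c₂) / 2 * DY * S + (c₂ / 2 * DY ^ 2 + Lyx * (c * DX) * DY) * (3 / 2)), ?_⟩
    intro n m X Y L τ β x y h hc hτ hβ hr T hT
    obtain ⟨hS0, hc₂, h1, h2⟩ := hr.convexConcave_rate h hc hτ hc₁ hβ hS hT
    have hDX := h.DX_nonneg
    have hDY := h.DY_nonneg
    have hLyx := h.Lyx_pos
    have hLxx := h.Lxx_nonneg
    have hLyy := h.Lyy_nonneg
    have hc0 : 0 < c := one_pos.trans_le hτ.one_le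
    refine SaddleLMOPO.div_bounds hT (by positivity) (by positivity) (by positivity)
      (by positivity) ?_ h2
    rwa [pow_zero, mul_one]
  · refine ⟨1, fun μ Lxx Lyx Lyy DX DY c hμ => ?_⟩
    obtain ⟨a, ha⟩ : ∃ a : ℝ, a = μ / (2 * (Lyy + μ)) := ⟨_, rfl⟩
    obtain ⟨C, hC⟩ : ∃ C : ℝ, C = Lyx * (c * DX) / μ := ⟨_, rfl⟩
    obtain ⟨S, hS⟩ : ∃ S : ℝ, S = (DY ^ 2 + C ^ 2 / a * 2) / a := ⟨_, rfl⟩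
    refine ⟨c * (DX * ((Lxx + Lyx ^ 2 / μ) * (c * DX) + 2 * Lyx * ((DY + C) / a)))
      + ((Lyy + μ) / 2 * S + Lyx * (c * DX) * ((2 + S) / 2)), ?_⟩
    intro n m X Y L τ x y h hc hτ hr T hT
    obtain ⟨ha0, hC0, hS0, h1, h2⟩ := hr.convexStronglyConcave_rate h hc hτ hμ ha hC hS hT
    have hDX := h.DX_nonneg
    have hDY := h.DY_nonneg
    have hLyx := h.Lyx_pos
    have hLxx := h.Lxx_nonneg
    have hLyy := h.Lyy_nonneg
    have hc0 : 0 < c := one_pos.trans_le hτ.one_le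
    have hlog : 0 ≤ Real.log T := Real.log_natCast_nonneg T
    have hT0 : (T : ℝ) ≠ 0 := by
      have : T ≠ 0 := by omega
      exact_mod_cast this
    have hTr : (T : ℝ) * (T : ℝ) ^ (-1 : ℝ) = 1 := by
      rw [Real.rpow_neg_one, mul_inv_cancel₀ hT0]
    refine SaddleLMOPO.div_bounds hT (by positivity) (by positivity) (by positivity)
      (by positivity) ?_ ?_
    · rwa [pow_one, hTr, mul_one]
    · rwa [hTr, mul_one]
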